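/- Let $n\ge 3$; indices of coordinates are read modulo $n$. For $l\ge 0$ let $B_l$ and $B^\vee_l$ be two copies of the set $\{x=(x_1,\dots,x_n)\in(\mathbb Z_{\ge0})^n : x_1+\cdots+x_n=l\}$. Put $$Q_i(x,y)=\min_{1\le k\le n}\Big(\sum_{j=1}^{k-1}x_{i+j}+\sum_{j=k+1}^{n}y_{i+j}\Big),\qquad P_i(x,y)=\min(x_{i+1},y_{i+1}).$$ The (classical) combinatorial $R$'s are the maps $x\otimes y\mapsto\tilde y\otimes\tilde x$, written $x\otimes y\simeq\tilde y\otimes\tilde x$, given by * $R:B_l\otimes B_m\to B_m\otimes B_l$, $\ \tilde x_i=x_i+Q_i(x,y)-Q_{i-1}(x,y)$, $\ \tilde y_i=y_i+Q_{i-1}(x,y)-Q_i(x,y)$; * $R^\vee:B_l\otimes B^\vee_m\to B^\vee_m\otimes B_l$, $\ \tilde x_i=x_i+P_i(x,y)-P_{i-1}(x,y)$, $\ \tilde y_i=y_i+P_i(x,y)-P_{i-1}(x,y)$; * $R^{\vee\vee}:B^\vee_l\otimes B^\vee_m\to B^\vee_m\otimes B^\vee_l$, $\ \tilde x_i=x_i+Q_{i-1}(y,x)-Q_i(y,x)$,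 $\ \tilde y_i=y_i+Q_i(y,x)-Q_{i-1}(y,x)$. Let $\kappa:B_l\to B^\vee_l$ be one of the following three maps, the last two being allowed only for even $n$: $$\kappa(x)=(x_2,\dots,x_n,x_1),\qquad \kappa(x)=(x_n,x_3,x_2,x_5,x_4,\dots,x_{n-1},x_{n-2},x_1),\qquad \kappa(x)=(x_2,x_1,x_4,x_3,\dots,x_n,x_{n-1}).$$ Let $u_l=(l,0,\dots,0)\in B_l$, $u_l^\vee=\kappa(u_l)\in B_l^\vee$, $B=B_1\otimes B_1^\vee$ and $\mathrm{vac}=u_1\otimes\kappa(u_1)\in B$. Let $$\mathcal P=\{\cdots\otimes p_2\otimes p_1 : p_k\in B \text{ for all } k\ge 1,\ p_k=\mathrm{vac}\text{ for all sufficiently large } k\}.$$ For $l\ge1$ the time evolution $T_l:\mathcal P\to\mathcal P$ is defined by the double-row construction $$u_l\otimes p\simeq p^\dagger\otimes v,\qquad p^\dagger\otimes\kappa(v)\simeq u^\vee_l\otimes T_l(p),$$ where $p^\dagger\in\mathcal P$ and $v\in B_l$. In the first relation a carrier, equal to $u_l$ far to the left, is moved from left to right through all the sites by $R$ and $R^\vee$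 (that is, by $B_l\otimes B\simeq B\otimes B_l$). In the second one the carrier $\kappa(v)$ is moved from right to left through all the sites by $R^{\vee\vee}$ and $R^\vee$ (that is, by $B\otimes B_l^\vee\simeq B_l^\vee\otimes B$), and it eventually becomes $u_l^\vee$. Then the time evolutions commute: $T_lT_m=T_mT_l$ on $\mathcal P$ for all $l,m\ge1$. -/

import Mathlib

namespace ReflectingAutomaton

/-! Indices of coordinates `x₁, …, xₙ` are read modulo `n`, i.e. they live in `ZMod n`
(the coordinate `xₙ` is the one with index `0`). -/

/-- Arrays `x = (x₁, …, xₙ)` of nonnegative integers with `x₁ + ⋯ + xₙ = l`. -/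
structure Arr (n : ℕ) [NeZero n] (l : ℕ) : Type where
  val : ZMod n → ℕ
  sum_eq : ∑ i, val i = l

/-- The set `B_l`: `xᵢ` is the number of letters `i` in a row of length `l`. -/
abbrev B (n : ℕ) [NeZero n] (l : ℕ) : Type := Arr n l

/-- The set `B^∨_l`: `xᵢ` is the number of letters `i` with a bar. It is presented by the
same arrays as `B_l`. -/
abbrev BVee (n : ℕ) [NeZero n] (l : ℕ) : Type := Arr n l

section CombinatorialR

set_option linter.unusedSectionVars false

variable {n : ℕ} [NeZero n]

theorem Arr.ext {l : ℕ} {x y : Arr n l} (h : ∀ i, x.1 i = y.1 i) : x = y := by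
  cases x
  cases y
  congr
  exact funext h

/-- `Qᵢ(x, y) = min_{1 ≤ k ≤ n} ( x_{i+1} + ⋯ + x_{i+k-1} + y_{i+k+1} + ⋯ + y_{i+n} )`. -/
def Q (x y : ZMod n → ℕ) (i : ZMod n) : ℕ :=
  (Finset.Icc 1 n).inf' ⟨1, Finset.mem_Icc.2 ⟨le_refl 1, NeZero.one_le⟩⟩ fun k =>
    ∑ j ∈ Finset.Icc 1 (k - 1), x (i + (j : ZMod n)) +
      ∑ j ∈ Finset.Icc (k + 1) n, y (i + (j : ZMod n))

/-- `Pᵢ(x, y) = min (x_{i+1}, y_{i+1})`. -/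
def P (x y : ZMod n → ℕ) (i : ZMod n) : ℕ := min (x (i + 1)) (y (i + 1))

theorem sum_shift (f : ZMod n → ℕ) (i : ZMod n) :
    ∑ j ∈ Finset.Icc 1 n, f (i + (j : ZMod n)) = ∑ j, f j := by
  have h : ∀ j : ZMod n, ∃ a ∈ Finset.Icc 1 n, i + (a : ZMod n) = j := by
    intro j
    by_cases hj : (j - i).val = 0
    · refine ⟨n, Finset.mem_Icc.2 ⟨NeZero.one_le, le_refl n⟩, ?_⟩
      have : j - i = 0 := (ZMod.val_eq_zero _).1 hj
      simp [sub_eq_zero.1 this]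
    · refine ⟨(j - i).val, Finset.mem_Icc.2 ⟨Nat.one_le_iff_ne_zero.2 hj,
        (ZMod.val_lt _).le⟩, ?_⟩
      simp
  have hs : Set.SurjOn (fun a : ℕ => i + (a : ZMod n)) (Finset.Icc 1 n)
      (Finset.univ : Finset (ZMod n)) := by
    intro j _
    obtain ⟨a, ha, e⟩ := h j
    exact ⟨a, ha, e⟩
  have hinj : Set.InjOn (fun a : ℕ => i + (a : ZMod n)) (Finset.Icc 1 n) :=
    Finset.injOn_of_surjOn_of_card_le _ (fun _ _ => Finset.mem_coe.2 (Finset.mem_univ _)) hs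
      (by simp [ZMod.card])
  refine Finset.sum_nbij (fun a : ℕ => i + (a : ZMod n)) (fun _ _ => Finset.mem_univ _)
    hinj hs (fun _ _ => rfl)

theorem Q_le (x y : ZMod n → ℕ) (i : ZMod n) {k : ℕ} (h1 : 1 ≤ k) (hk : k ≤ n) :
    Q x y i ≤ ∑ j ∈ Finset.Icc 1 (k - 1), x (i + (j : ZMod n)) +
      ∑ j ∈ Finset.Icc (k + 1) n, y (i + (j : ZMod n)) :=
  Finset.inf'_le _ (Finset.mem_Icc.2 ⟨h1, hk⟩)

theorem Q_attained (x y : ZMod n → ℕ) (i : ZMod n) : ∃ k, 1 ≤ k ∧ k ≤ n ∧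
    Q x y i = ∑ j ∈ Finset.Icc 1 (k - 1), x (i + (j : ZMod n)) +
      ∑ j ∈ Finset.Icc (k + 1) n, y (i + (j : ZMod n)) := by
  obtain ⟨k, hk, e⟩ := Finset.exists_mem_eq_inf' (s := Finset.Icc 1 n)
    ⟨1, Finset.mem_Icc.2 ⟨le_refl 1, NeZero.one_le⟩⟩ (fun k : ℕ =>
    ∑ j ∈ Finset.Icc 1 (k - 1), x (i + (j : ZMod n)) +
      ∑ j ∈ Finset.Icc (k + 1) n, y (i + (j : ZMod n)))
  rw [Finset.mem_Icc] at hk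
  exact ⟨k, hk.1, hk.2, e⟩

theorem sum_Icc_shift (f : ZMod n → ℕ) (i : ZMod n) (a b : ℕ) :
    ∑ j ∈ Finset.Icc (a + 1) (b + 1), f (i - 1 + (j : ZMod n)) =
      ∑ j ∈ Finset.Icc a b, f (i + (j : ZMod n)) := by
  rw [← Finset.map_add_right_Icc, Finset.sum_map]
  refine Finset.sum_congr rfl fun j _ => ?_
  congr 1
  simp only [addRightEmbedding_apply]
  push_cast
  ring

/-- The first array of coordinates produced by the combinatorial `R` is nonnegative. -/
theorem Q_pred_le (x y : ZMod n → ℕ) (i : ZMod n) : Q x y (i - 1) ≤ x i + Q x y i := by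
  obtain ⟨k, h1, hk, e⟩ := Q_attained x y i
  rw [e]
  rcases Nat.lt_or_ge k n with h | h
  · have hq := Q_le x y (i - 1) (k := k + 1) (by omega) (by omega)
    have a1 : ∑ j ∈ Finset.Icc 1 (k + 1 - 1), x (i - 1 + (j : ZMod n)) =
        x i + ∑ j ∈ Finset.Icc 1 (k - 1), x (i + (j : ZMod n)) := by
      have := sum_Icc_shift x i 0 (k - 1)
      rw [Nat.sub_add_cancel h1] at this
      rw [Nat.add_sub_cancel]
      rw [zero_add] at this
      rw [this, ← Finset.add_sum_Ioc_eq_sum_Icc (Nat.zero_le _)]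
      simp only [Nat.cast_zero, add_zero]
      rfl
    have a2 : ∑ j ∈ Finset.Icc (k + 1 + 1) n, y (i - 1 + (j : ZMod n)) ≤
        ∑ j ∈ Finset.Icc (k + 1) n, y (i + (j : ZMod n)) := by
      rw [← sum_Icc_shift y i (k + 1) n]
      exact Finset.sum_le_sum_of_subset (Finset.Icc_subset_Icc_right (Nat.le_succ n))
    omega
  · obtain rfl : k = n := le_antisymm hk h
    have hq := Q_le x y (i - 1) (k := k) h1 le_rfl
    have e1 : ∀ (f : ZMod k → ℕ) (i : ZMod k), ∑ j ∈ Finset.Icc 1 k, f (i + (j : ZMod k)) =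
        ∑ j ∈ Finset.Icc 1 (k - 1), f (i + (j : ZMod k)) + f i := by
      intro f i
      obtain ⟨r, rfl⟩ : ∃ r, k = r + 1 := ⟨k - 1, by omega⟩
      rw [Finset.sum_Icc_succ_top (by omega)]
      have hz : i + ((r + 1 : ℕ) : ZMod (r + 1)) = i := by
        rw [ZMod.natCast_self, add_zero]
      rw [hz]
      rfl
    have b1 := e1 x i
    have b2 := e1 x (i - 1)
    have b3 := sum_shift x i
    have b4 := sum_shift x (i - 1)
    have b5 : Finset.Icc (k + 1) k = ∅ := by simp
    simp only [b5, Finset.sum_empty] at hq ⊢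
    omega

/-- The second array of coordinates produced by the combinatorial `R` is nonnegative. -/
theorem Q_le_pred (x y : ZMod n → ℕ) (i : ZMod n) : Q x y i ≤ y i + Q x y (i - 1) := by
  obtain ⟨k, h1, hk, e⟩ := Q_attained x y (i - 1)
  rw [e]
  have top : ∀ a, a ≤ n → ∑ j ∈ Finset.Icc (a + 1 + 1) (n + 1), y (i - 1 + (j : ZMod n)) =
      ∑ j ∈ Finset.Icc (a + 1) n, y (i + (j : ZMod n)) := fun a _ => sum_Icc_shift y i (a + 1) n
  have last : ∀ a, a ≤ n → ∑ j ∈ Finset.Icc (a + 1) (n + 1), y (i - 1 + (j : ZMod n)) =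
      ∑ j ∈ Finset.Icc (a + 1) n, y (i - 1 + (j : ZMod n)) + y i := by
    intro a ha
    rw [Finset.sum_Icc_succ_top (by omega)]
    have hz : i - 1 + ((n + 1 : ℕ) : ZMod n) = i := by
      push_cast
      rw [ZMod.natCast_self]
      ring
    rw [hz]
  rcases Nat.lt_or_ge 1 k with h | h
  · have hq := Q_le x y i (k := k - 1) (by omega) (by omega)
    obtain ⟨r, rfl⟩ : ∃ r, k = r + 2 := ⟨k - 2, by omega⟩
    have t := top (r + 1) (by omega)
    rw [show r + 1 + 1 + 1 = r + 2 + 1 by omega] at t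
    have s := last (r + 2) hk
    have a1 : ∑ j ∈ Finset.Icc 1 (r + 2 - 1 - 1), x (i + (j : ZMod n)) ≤
        ∑ j ∈ Finset.Icc 1 (r + 2 - 1), x (i - 1 + (j : ZMod n)) := by
      have := sum_Icc_shift x i 0 r
      rw [zero_add] at this
      rw [show r + 2 - 1 - 1 = r by omega, show r + 2 - 1 = r + 1 by omega, this]
      exact Finset.sum_le_sum_of_subset (Finset.Icc_subset_Icc_left (by omega))
    simp only [show r + 2 - 1 + 1 = r + 1 + 1 by omega] at hq
    omega
  · obtain rfl : k = 1 := le_antisymm h h1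
    have hq := Q_le x y i (k := 1) le_rfl hk
    have s := last 1 hk
    have t := top 0 (by omega)
    simp only [zero_add] at t
    have hsub : ∑ j ∈ Finset.Icc (1 + 1) n, y (i + (j : ZMod n)) ≤
        ∑ j ∈ Finset.Icc 1 n, y (i + (j : ZMod n)) :=
      Finset.sum_le_sum_of_subset (Finset.Icc_subset_Icc_left (by omega))
    simp only [Nat.sub_self, show (Finset.Icc 1 0 : Finset ℕ) = ∅ by simp,
      Finset.sum_empty, zero_add] at hq ⊢
    omega

theorem P_pred_le_left (x y : ZMod n → ℕ) (i : ZMod n) : P x y (i - 1) ≤ x i := by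
  simp [P]

theorem P_pred_le_right (x y : ZMod n → ℕ) (i : ZMod n) : P x y (i - 1) ≤ y i := by
  simp [P]

/-- Adding a total difference does not change the sum of the coordinates. -/
theorem sum_add_sub {l : ℕ} (x F G : ZMod n → ℕ) (h : ∀ i, G i ≤ x i + F i)
    (hx : ∑ i, x i = l) (hFG : ∑ i, F i = ∑ i, G i) : ∑ i, (x i + F i - G i) = l := by
  have h2 : ∑ i, (x i + F i - G i) + ∑ i, G i = ∑ i, x i + ∑ i, F i := by
    rw [← Finset.sum_add_distrib, ← Finset.sum_add_distrib]
    exact Finset.sum_congr rfl fun i _ => Nat.sub_add_cancel (h i)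
  omega

theorem sum_pred (F : ZMod n → ℕ) : ∑ i, F (i - 1) = ∑ i, F i :=
  Equiv.sum_comp (Equiv.subRight (1 : ZMod n)) F

variable {l m : ℕ}

/-- The classical combinatorial `R : B_l ⊗ B_m → B_m ⊗ B_l`, `x ⊗ y ↦ ỹ ⊗ x̃` with
`x̃ᵢ = xᵢ + Qᵢ(x,y) - Q_{i-1}(x,y)`, `ỹᵢ = yᵢ + Q_{i-1}(x,y) - Qᵢ(x,y)`.
(By `Q_pred_le` and `Q_le_pred` the subtractions are genuine.) -/
def R (x : B n l) (y : B n m) : B n m × B n l :=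
  (⟨fun i => y.1 i + Q x.1 y.1 (i - 1) - Q x.1 y.1 i,
      sum_add_sub _ _ _ (Q_le_pred x.1 y.1) y.2 (sum_pred _)⟩,
    ⟨fun i => x.1 i + Q x.1 y.1 i - Q x.1 y.1 (i - 1),
      sum_add_sub _ _ _ (Q_pred_le x.1 y.1) x.2 (sum_pred _).symm⟩)

/-- The classical combinatorial `R^∨ : B_l ⊗ B^∨_m → B^∨_m ⊗ B_l`, `x ⊗ y ↦ ỹ ⊗ x̃` with
`x̃ᵢ = xᵢ + Pᵢ(x,y) - P_{i-1}(x,y)`, `ỹᵢ = yᵢ + Pᵢ(x,y) - P_{i-1}(x,y)`. -/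
def RVee (x : B n l) (y : BVee n m) : BVee n m × B n l :=
  (⟨fun i => y.1 i + P x.1 y.1 i - P x.1 y.1 (i - 1),
      sum_add_sub _ _ _ (fun i => (P_pred_le_right x.1 y.1 i).trans (Nat.le_add_right _ _)) y.2
        (sum_pred _).symm⟩,
    ⟨fun i => x.1 i + P x.1 y.1 i - P x.1 y.1 (i - 1),
      sum_add_sub _ _ _ (fun i => (P_pred_le_left x.1 y.1 i).trans (Nat.le_add_right _ _)) x.2
        (sum_pred _).symm⟩)

/-- The classical combinatorial `R^∨∨ : B^∨_l ⊗ B^∨_m → B^∨_m ⊗ B^∨_l`, `x ⊗ y ↦ ỹ ⊗ x̃` with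
`x̃ᵢ = xᵢ + Q_{i-1}(y,x) - Qᵢ(y,x)`, `ỹᵢ = yᵢ + Qᵢ(y,x) - Q_{i-1}(y,x)`. -/
def RVeeVee (x : BVee n l) (y : BVee n m) : BVee n m × BVee n l :=
  (⟨fun i => y.1 i + Q y.1 x.1 i - Q y.1 x.1 (i - 1),
      sum_add_sub _ _ _ (Q_pred_le y.1 x.1) y.2 (sum_pred _).symm⟩,
    ⟨fun i => x.1 i + Q y.1 x.1 (i - 1) - Q y.1 x.1 i,
      sum_add_sub _ _ _ (Q_le_pred y.1 x.1) x.2 (sum_pred _)⟩)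

end CombinatorialR

section CombinatorialK

/-- The three types of reflecting end; the last two exist for even `n` only. -/
inductive EndType (n : ℕ) : Type
  | rotateLeft : EndType n
  | switch1n (h : Even n) : EndType n
  | switch12 (h : Even n) : EndType n

variable {n : ℕ} [NeZero n]

theorem even_val_iff (h : Even n) (i : ZMod n) :
    Even i.val ↔ ZMod.castHom h.two_dvd (ZMod 2) i = 0 := by
  rw [← (ZMod.natCast_eq_zero_iff_even (n := i.val)), ← map_natCast (ZMod.castHom h.two_dvd (ZMod 2)),
    ZMod.natCast_zmod_val]

theorem even_val_add_one (h : Even n) (i : ZMod n) : Even (i + 1).val ↔ ¬ Even i.val := by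
  rw [even_val_iff h, even_val_iff h, map_add, map_one]
  generalize ZMod.castHom h.two_dvd (ZMod 2) i = a
  revert a
  decide

theorem even_val_sub_one (h : Even n) (i : ZMod n) : Even (i - 1).val ↔ ¬ Even i.val := by
  have := even_val_add_one h (i - 1)
  rw [sub_add_cancel] at this
  tauto

/-- The index map `n ↔ 1, 2 ↔ 3, 4 ↔ 5, …` (for even `n`). -/
def swap1n (i : ZMod n) : ZMod n := if Even i.val then i + 1 else i - 1

/-- The index map `1 ↔ 2, 3 ↔ 4, …, n-1 ↔ n` (for even `n`). -/
def swap12 (i : ZMod n) : ZMod n := if Even i.val then i - 1 else i + 1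

theorem swap1n_involutive (h : Even n) : Function.Involutive (swap1n (n := n)) := by
  intro i
  by_cases hi : Even i.val
  · simp [swap1n, hi, even_val_add_one h]
  · simp [swap1n, hi, even_val_sub_one h]

theorem swap12_involutive (h : Even n) : Function.Involutive (swap12 (n := n)) := by
  intro i
  by_cases hi : Even i.val
  · simp [swap12, hi, even_val_sub_one h]
  · simp [swap12, hi, even_val_add_one h]

/-- The permutation `σ` of the indices such that `κ(x)ᵢ = x_{σ(i)}`. -/
def EndType.perm : EndType n → Equiv.Perm (ZMod n)
  | .rotateLeft => Equiv.addRight 1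
  | .switch1n h => (swap1n_involutive h).toPerm
  | .switch12 h => (swap12_involutive h).toPerm

/-- The classical part `κ : B_l → B^∨_l` of the combinatorial `K`:
* `rotateLeft`: `κ(x) = (x₂, …, xₙ, x₁)`,
* `switch1n`: `κ(x) = (xₙ, x₃, x₂, x₅, x₄, …, x_{n-1}, x_{n-2}, x₁)`,
* `switch12`: `κ(x) = (x₂, x₁, x₄, x₃, …, xₙ, x_{n-1})`. -/
def kappa (e : EndType n) {l : ℕ} (x : B n l) : BVee n l :=
  ⟨fun i => x.1 (e.perm i), (Equiv.sum_comp e.perm x.1).trans x.2⟩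

end CombinatorialK

section States

variable {n : ℕ} [NeZero n]

/-- `u_l = (l, 0, …, 0) ∈ B_l`. -/
def u (n : ℕ) [NeZero n] (l : ℕ) : B n l :=
  ⟨Pi.single 1 l, by simp⟩

/-- `u^∨_l = κ(u_l) ∈ B^∨_l`. -/
def uVee (e : EndType n) (l : ℕ) : BVee n l := kappa e (u n l)

/-- Local states: elements of `B = B_1 ⊗ B^∨_1`. -/
abbrev LocalState (n : ℕ) [NeZero n] : Type := B n 1 × BVee n 1

/-- The vacuum `vac = 1 ⊗ κ(1)`. -/
def vac (e : EndType n) : LocalState n := (u n 1, kappa e (u n 1))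

/-- The set of states `⋯ ⊗ p₂ ⊗ p₁` on the semi-infinite lattice, all but finitely many of whose
local states are `vac`. The site with number `k + 1`, counted to the left from the reflecting
end, carries the local state `site k`. -/
structure State (e : EndType n) : Type where
  site : ℕ → LocalState n
  eventually_vac : ∃ N, ∀ k, N ≤ k → site k = vac e

/-- `B_l ⊗ B ≃ B ⊗ B_l`: a carrier in `B_l` passes a site from left to right. -/
def passRight {l : ℕ} (v : B n l) (b : LocalState n) : LocalState n × B n l :=
  let r₁ := R v b.1
  let r₂ := RVee r₁.2 b.2
  ((r₁.1, r₂.1), r₂.2)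

/-- `B ⊗ B^∨_l ≃ B^∨_l ⊗ B`: a carrier in `B^∨_l` passes a site from right to left. -/
def passLeft {l : ℕ} (b : LocalState n) (w : BVee n l) : BVee n l × LocalState n :=
  let r₁ := RVeeVee b.2 w
  let r₂ := RVee b.1 r₁.1
  (r₂.1, (r₂.2, r₁.2))

theorem perm_ne (e : EndType n) (hn : n ≠ 1) (i : ZMod n) : e.perm i ≠ i := by
  have h1 : (1 : ZMod n) ≠ 0 := by
    intro h
    have : Subsingleton (ZMod n) := subsingleton_of_zero_eq_one h.symm
    have hc := Fintype.card_le_one_iff_subsingleton.2 this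
    rw [ZMod.card] at hc
    have := NeZero.ne n
    omega
  cases e with
  | rotateLeft => simpa [EndType.perm] using h1
  | switch1n h =>
    simp only [EndType.perm, Function.Involutive.coe_toPerm, swap1n]
    split_ifs <;> simpa using h1
  | switch12 h =>
    simp only [EndType.perm, Function.Involutive.coe_toPerm, swap12]
    split_ifs <;> simpa using h1

theorem arr_subsingleton (hn : n = 1) {l : ℕ} (x y : Arr n l) : x = y := by
  subst hn
  refine Arr.ext fun i => ?_
  have hx := x.2
  have hy := y.2
  rw [Fintype.sum_subsingleton _ i] at hx hy
  rw [hx, hy]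

/-- `κ(u_l)` is concentrated in one coordinate. -/
theorem uVee_val (e : EndType n) (l : ℕ) :
    (uVee e l).1 = Pi.single (e.perm.symm 1) l := by
  funext i
  simp only [uVee, kappa, u, Pi.single_apply, Equiv.eq_symm_apply]

theorem Q_single (a : ZMod n) (l m : ℕ) (i : ZMod n) :
    Q (Pi.single a l) (Pi.single a m) i = 0 := by
  have key : ∀ (c : ℕ) (k : ℕ) (s : Finset ℕ), i + (k : ZMod n) = a → 1 ≤ k → k ≤ n →
      (∀ j ∈ s, j ≠ k ∧ 1 ≤ j ∧ j ≤ n) →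
      ∑ j ∈ s, (Pi.single a c : ZMod n → ℕ) (i + (j : ZMod n)) = 0 := by
    intro c k s hk h1 h2 hs
    refine Finset.sum_eq_zero fun j hj => ?_
    obtain ⟨hne, j1, j2⟩ := hs j hj
    refine Pi.single_eq_of_ne (fun h => hne ?_) _
    rw [← hk] at h
    have h' := (ZMod.natCast_eq_natCast_iff _ _ _).1 (add_left_cancel h)
    rcases Nat.lt_or_gt_of_ne hne with hlt | hlt
    · have := Nat.le_of_dvd (by omega) ((Nat.modEq_iff_dvd' hlt.le).1 h')
      omega
    · have := Nat.le_of_dvd (by omega) ((Nat.modEq_iff_dvd' hlt.le).1 h'.symm)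
      omega
  obtain ⟨k, h1, h2, hk⟩ : ∃ k : ℕ, 1 ≤ k ∧ k ≤ n ∧ i + (k : ZMod n) = a := by
    by_cases hj : (a - i).val = 0
    · refine ⟨n, NeZero.one_le, le_refl n, ?_⟩
      simp [sub_eq_zero.1 ((ZMod.val_eq_zero _).1 hj)]
    · exact ⟨(a - i).val, Nat.one_le_iff_ne_zero.2 hj, (ZMod.val_lt _).le, by simp⟩
  have hq := Q_le (Pi.single a l) (Pi.single a m) i h1 h2
  rw [key l k _ hk h1 h2 (fun j hj => by rw [Finset.mem_Icc] at hj; omega),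
    key m k _ hk h1 h2 (fun j hj => by rw [Finset.mem_Icc] at hj; omega)] at hq
  omega

theorem R_u (l m : ℕ) : R (u n l) (u n m) = (u n m, u n l) := by
  refine Prod.ext (Arr.ext fun i => ?_) (Arr.ext fun i => ?_) <;>
  simp only [R, u, Q_single] <;> simp

theorem RVeeVee_uVee (e : EndType n) (l m : ℕ) :
    RVeeVee (uVee e l) (uVee e m) = (uVee e m, uVee e l) := by
  refine Prod.ext (Arr.ext fun i => ?_) (Arr.ext fun i => ?_) <;>
  simp only [RVeeVee, uVee_val, Q_single] <;> simp

theorem RVee_u_uVee (e : EndType n) (l m : ℕ) :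
    RVee (u n l) (uVee e m) = (uVee e m, u n l) := by
  by_cases hn : n = 1
  · exact Prod.ext (arr_subsingleton hn _ _) (arr_subsingleton hn _ _)
  have hP : ∀ i, P (u n l).1 (uVee e m).1 i = 0 := by
    intro i
    rw [uVee_val]
    simp only [P, u, Pi.single_apply]
    split_ifs with h1 h2
    · exfalso
      rw [h1, Equiv.eq_symm_apply] at h2
      exact perm_ne e hn _ h2
    all_goals simp
  refine Prod.ext (Arr.ext fun i => ?_) (Arr.ext fun i => ?_) <;>
  simp only [RVee, hP] <;> simp

/-- `u_l ⊗ vac ≃ vac ⊗ u_l`. -/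
theorem passRight_vac (e : EndType n) (l : ℕ) :
    passRight (u n l) (vac e) = (vac e, u n l) := by
  have h := RVee_u_uVee e l 1
  simp only [passRight, vac, R_u]
  change ((u n 1, (RVee (u n l) (uVee e 1)).1), (RVee (u n l) (uVee e 1)).2) = _
  rw [h]
  rfl

/-- `vac ⊗ u^∨_l ≃ u^∨_l ⊗ vac`. -/
theorem passLeft_vac (e : EndType n) (l : ℕ) :
    passLeft (vac e) (uVee e l) = (uVee e l, vac e) := by
  have h := RVeeVee_uVee e 1 l
  have h' := RVee_u_uVee e 1 l
  simp only [passLeft, vac]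
  change ((RVee (u n 1) (RVeeVee (uVee e 1) (uVee e l)).1).1,
    ((RVee (u n 1) (RVeeVee (uVee e 1) (uVee e l)).1).2,
      (RVeeVee (uVee e 1) (uVee e l)).2)) = _
  rw [h, h']
  rfl

/-- Passing a vacuum increases the distinguished coordinate of a carrier, up to saturation. -/
theorem passLeft_vac_coord (e : EndType n) (l : ℕ) (w : BVee n l) :
    min l (w.1 (e.perm.symm 1) + 1) ≤ (passLeft (vac e) w).1.1 (e.perm.symm 1) := by
  by_cases hn : n = 1
  · rw [arr_subsingleton hn (passLeft (vac e) w).1 (uVee e l), uVee_val]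
    simp
  set c := e.perm.symm 1 with hc
  have hc1 : c ≠ 1 := by
    intro h
    rw [hc, Equiv.symm_apply_eq] at h
    exact perm_ne e hn _ h.symm
  have hx : (vac e).2.1 = Pi.single c 1 := uVee_val e 1
  have step1 : min l (w.1 c + 1) ≤ (RVeeVee (vac e).2 w).1.1 c := by
    change _ ≤ w.1 c + Q w.1 (vac e).2.1 c - Q w.1 (vac e).2.1 (c - 1)
    rw [hx]
    have h0 : Q w.1 (Pi.single c 1) (c - 1) = 0 := by
      have hq := Q_le w.1 (Pi.single c 1) (c - 1) (k := 1) le_rfl NeZero.one_le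
      have hz : ∑ j ∈ Finset.Icc (1 + 1) n, (Pi.single c 1 : ZMod n → ℕ)
          (c - 1 + (j : ZMod n)) = 0 := by
        refine Finset.sum_eq_zero fun j hj => Pi.single_eq_of_ne (fun h => ?_) _
        rw [Finset.mem_Icc] at hj
        have h2 : ((j : ℕ) : ZMod n) = ((1 : ℕ) : ZMod n) := by
          push_cast
          linear_combination h
        have h3 := (ZMod.natCast_eq_natCast_iff _ _ _).1 h2
        have := Nat.le_of_dvd (by omega) ((Nat.modEq_iff_dvd' (by omega)).1 h3.symm)
        omega
      rw [hz] at hq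
      simpa using hq
    have htot : ∑ j ∈ Finset.Icc 1 (n - 1), w.1 (c + (j : ZMod n)) + w.1 c = l := by
      have := sum_shift w.1 c
      rw [w.2] at this
      refine Eq.trans ?_ this
      have hnn : n = (n - 1) + 1 := by
        have := NeZero.ne n
        omega
      have hI : Finset.Icc 1 n = insert n (Finset.Icc 1 (n - 1)) := by
        ext j
        simp only [Finset.mem_insert, Finset.mem_Icc]
        omega
      rw [hI, Finset.sum_insert (by simp only [Finset.mem_Icc]; omega)]
      simp [add_comm]
    obtain ⟨k, h1, hk, ek⟩ := Q_attained w.1 (Pi.single c 1) c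
    rw [h0, ek]
    rcases Nat.lt_or_ge k n with h | h
    · have : 1 ≤ ∑ j ∈ Finset.Icc (k + 1) n, (Pi.single c 1 : ZMod n → ℕ)
          (c + (j : ZMod n)) := by
        have hs := Finset.single_le_sum
          (f := fun j : ℕ => (Pi.single c 1 : ZMod n → ℕ) (c + (j : ZMod n)))
          (fun j _ => Nat.zero_le _) (Finset.mem_Icc.2 ⟨h, le_refl n⟩)
        simpa using hs
      omega
    · have hkn : k = n := le_antisymm hk h
      have h5 : Finset.Icc (k + 1) n = ∅ := by
        rw [hkn]
        simp
      rw [h5, hkn, Finset.sum_empty]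
      omega
  refine step1.trans ?_
  change _ ≤ (RVeeVee (vac e).2 w).1.1 c + P (vac e).1.1 (RVeeVee (vac e).2 w).1.1 c -
    P (vac e).1.1 (RVeeVee (vac e).2 w).1.1 (c - 1)
  have hp : P (vac e).1.1 (RVeeVee (vac e).2 w).1.1 (c - 1) = 0 := by
    simp [P, vac, u, hc1]
  omega

theorem eq_uVee (e : EndType n) (l : ℕ) (w : BVee n l) (h : l ≤ w.1 (e.perm.symm 1)) :
    w = uVee e l := by
  refine Arr.ext fun i => ?_
  rw [uVee_val]
  have hs := w.2
  rw [← Finset.add_sum_erase _ _ (Finset.mem_univ (e.perm.symm 1))] at hs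
  by_cases hi : i = e.perm.symm 1
  · subst hi
    simp only [Pi.single_eq_same]
    omega
  · rw [Pi.single_eq_of_ne hi]
    have := Finset.single_le_sum (f := w.1) (fun j _ => Nat.zero_le _)
      (Finset.mem_erase.2 ⟨hi, Finset.mem_univ i⟩)
    omega

end States

section TimeEvolution

variable {n : ℕ} [NeZero n]

/-- The carrier obtained from `u_l` by passing the `N` sites `p_{N-1}, …, p_1, p_0` from left to
right. -/
def carryRight (l : ℕ) : ℕ → (ℕ → LocalState n) → B n l
  | 0, _ => u n l
  | N + 1, p => (passRight (carryRight l N fun k => p (k + 1)) (p 0)).2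

/-- A number of sites to the left of which the state `p` consists of vacua only. -/
noncomputable def State.range {e : EndType n} (p : State e) : ℕ :=
  p.eventually_vac.choose

theorem State.site_eq_vac {e : EndType n} (p : State e) {k : ℕ} (h : p.range ≤ k) :
    p.site k = vac e :=
  p.eventually_vac.choose_spec k h

variable {e : EndType n} (l : ℕ) (p : State e)

/-- The carrier in `B_l` that comes from the far left as `u_l`, after it has passed all sites `j`
of `p` with `j ≥ k`. -/
noncomputable def rightCarrier (k : ℕ) : B n l :=
  carryRight l (p.range - k) fun j => p.site (k + j)

theorem rightCarrier_of_le {k : ℕ} (h : p.range ≤ k) : rightCarrier l p k = u n l := by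
  rw [rightCarrier, Nat.sub_eq_zero_of_le h]
  rfl

/-- The state `p^†` in `u_l ⊗ p ≃ p^† ⊗ v`. -/
noncomputable def dagger : State e where
  site k := (passRight (rightCarrier l p (k + 1)) (p.site k)).1
  eventually_vac := ⟨p.range, fun k hk => by
    rw [rightCarrier_of_le l p (hk.trans (Nat.le_succ k)), p.site_eq_vac hk, passRight_vac]⟩

/-- The element `v ∈ B_l` in `u_l ⊗ p ≃ p^† ⊗ v`. -/
noncomputable def endCarrier : B n l := rightCarrier l p 0

/-- The carriers of the first row obey the local rule at every site. -/
theorem passRight_rightCarrier (k : ℕ) :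
    passRight (rightCarrier l p (k + 1)) (p.site k) =
      ((dagger l p).site k, rightCarrier l p k) := by
  refine Prod.ext rfl ?_
  rcases Nat.lt_or_ge k p.range with h | h
  · rw [rightCarrier, rightCarrier, show p.range - k = (p.range - (k + 1)) + 1 by omega]
    simp only [carryRight, add_zero]
    congr 3
    funext j
    congr 1
    omega
  · rw [rightCarrier_of_le l p h, rightCarrier_of_le l p (h.trans (Nat.le_succ k)),
      p.site_eq_vac h, passRight_vac]

/-- The carrier in `B^∨_l` that starts at the reflecting end as `κ(v)`, after it has passed the
first `k` sites of `p^†` from right to left. -/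
noncomputable def leftCarrier : ℕ → BVee n l
  | 0 => kappa e (endCarrier l p)
  | k + 1 => (passLeft ((dagger l p).site k) (leftCarrier k)).1

/-- The carrier moving to the left becomes `u^∨_l`. -/
theorem leftCarrier_eventually :
    ∃ N, ∀ k, N ≤ k → leftCarrier l p k = uVee e l ∧ (dagger l p).site k = vac e := by
  set q := dagger l p with hq
  have hgrow : ∀ j, min l j ≤ (leftCarrier l p (q.range + j)).1 (e.perm.symm 1) := by
    intro j
    induction j with
    | zero => simp
    | succ j ih =>
      have h := passLeft_vac_coord e l (leftCarrier l p (q.range + j))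
      rw [← q.site_eq_vac (Nat.le_add_right q.range j)] at h
      change _ ≤ (leftCarrier l p (q.range + j + 1)).1 _ at h
      rw [← add_assoc]
      omega
  refine ⟨q.range + l, fun k hk => ⟨?_, q.site_eq_vac (by omega)⟩⟩
  apply eq_uVee
  have h := hgrow (k - q.range)
  rw [Nat.add_sub_cancel' (by omega)] at h
  omega

/-- The time evolution `T_l`, defined by `u_l ⊗ p ≃ p^† ⊗ v` and
`p^† ⊗ κ(v) ≃ u^∨_l ⊗ T_l(p)`. -/
noncomputable def T (l : ℕ) (p : State e) : State e where
  site k := (passLeft ((dagger l p).site k) (leftCarrier l p k)).2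
  eventually_vac := by
    obtain ⟨N, hN⟩ := leftCarrier_eventually l p
    refine ⟨N, fun k hk => ?_⟩
    rw [(hN k hk).1, (hN k hk).2, passLeft_vac]

end TimeEvolution

end ReflectingAutomaton

/-! Commutativity is a consequence of the Yang–Baxter equations for `R`, `R^∨`, `R^∨∨` and the
reflection equation for `κ`. A wall with finitely many sites in front of it acts on an incoming
carrier like a wall whose internal state is the list of sites (`dress`). Induction on the number of
sites carries the reflection equation from the bare wall to the dressed one (`dress_reflection`).
For the two carriers `u_l` and `u_m`, which cross each other unchanged both before and after a
reflection, it says that evolving the sites by `T m` and then `T l` gives the same as the opposite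
order. Far to the left only vacua and settled carriers occur, so long finite lists suffice.

The local equations are piecewise linear identities and are proved through a subtraction-free lift:
minimum becomes sum, sum becomes product, and the maps become rational maps of positive arrays. A
family decaying like `2 ^ (-a s)` determines its exponent `a`, and the exponents follow the
piecewise linear maps, so rational identities descend (`Trop.unique`).

The lifted `R` exchanges the factors of a product of two Lax operators, and such factorizations are
unique when the products of coordinates (the levels) differ; this gives the Yang–Baxter equation
without `∨`. The mixed and reflection equations rest on another uniqueness: `geomQ` is the only
solution of a cyclic first-order recursion (`eq_geomQ`), so an explicit solution identifies it. The
piecewise linear statements involve no levels of the lifts, which can therefore be chosen distinct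
(`exists_lifts`). -/

namespace ReflectingAutomaton

set_option linter.unusedSectionVars false

/-! ### The rational lifts of the combinatorial `R`'s -/

section GeometricR

variable {n : ℕ} [NeZero n]

theorem prod_shift (f : ZMod n → ℝ) (i : ZMod n) :
    ∏ j ∈ Finset.Icc 1 n, f (i + (j : ZMod n)) = ∏ j, f j := by
  have hs : Set.SurjOn (fun a : ℕ => i + (a : ZMod n)) (Finset.Icc 1 n)
      (Finset.univ : Finset (ZMod n)) := by
    intro j _
    by_cases hj : (j - i).val = 0
    · refine ⟨n, Finset.mem_coe.2 (Finset.mem_Icc.2 ⟨NeZero.one_le, le_refl n⟩), ?_⟩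
      have : j - i = 0 := (ZMod.val_eq_zero _).1 hj
      simp [sub_eq_zero.1 this]
    · refine ⟨(j - i).val, Finset.mem_coe.2 (Finset.mem_Icc.2 ⟨Nat.one_le_iff_ne_zero.2 hj,
        (ZMod.val_lt _).le⟩), ?_⟩
      simp
  have hinj : Set.InjOn (fun a : ℕ => i + (a : ZMod n)) (Finset.Icc 1 n) :=
    Finset.injOn_of_surjOn_of_card_le _ (fun _ _ => Finset.mem_coe.2 (Finset.mem_univ _)) hs
      (by simp [ZMod.card])
  exact Finset.prod_nbij (fun a : ℕ => i + (a : ZMod n)) (fun _ _ => Finset.mem_univ _)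
    hinj hs (fun _ _ => rfl)

theorem prod_Icc_shift (f : ZMod n → ℝ) (i : ZMod n) (a b : ℕ) :
    ∏ j ∈ Finset.Icc (a + 1) (b + 1), f (i - 1 + (j : ZMod n)) =
      ∏ j ∈ Finset.Icc a b, f (i + (j : ZMod n)) := by
  rw [← Finset.map_add_right_Icc, Finset.prod_map]
  refine Finset.prod_congr rfl fun j _ => ?_
  congr 1
  simp only [addRightEmbedding_apply]
  push_cast
  ring

theorem prod_pred (F : ZMod n → ℝ) : ∏ i, F (i - 1) = ∏ i, F i :=
  Equiv.prod_comp (Equiv.subRight (1 : ZMod n)) F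

theorem prod_succ (F : ZMod n → ℝ) : ∏ i, F (i + 1) = ∏ i, F i :=
  Equiv.prod_comp (Equiv.addRight (1 : ZMod n)) F

/-- The summands of `geomQ`. -/
noncomputable def geomQTerm (x y : ZMod n → ℝ) (i : ZMod n) (k : ℕ) : ℝ :=
  (∏ j ∈ Finset.Icc 1 (k - 1), x (i + (j : ZMod n))) *
    ∏ j ∈ Finset.Icc (k + 1) n, y (i + (j : ZMod n))

/-- The geometric lift of `Q`: minima become sums and sums become products. -/
noncomputable def geomQ (x y : ZMod n → ℝ) (i : ZMod n) : ℝ :=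
  ∑ k ∈ Finset.Icc 1 n, geomQTerm x y i k

theorem geomQ_pos {x y : ZMod n → ℝ} (hx : ∀ i, 0 < x i) (hy : ∀ i, 0 < y i) (i : ZMod n) :
    0 < geomQ x y i :=
  Finset.sum_pos (fun _ _ => mul_pos (Finset.prod_pos fun _ _ => hx _)
    (Finset.prod_pos fun _ _ => hy _)) ⟨1, Finset.mem_Icc.2 ⟨le_refl 1, NeZero.one_le⟩⟩

theorem mul_geomQTerm (x y : ZMod n → ℝ) (i : ZMod n) (k : ℕ) (h1 : 1 ≤ k) (hk : k < n) :
    x i * geomQTerm x y i k = y i * geomQTerm x y (i - 1) (k + 1) := by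
  obtain ⟨r, rfl⟩ : ∃ r, k = r + 1 := ⟨k - 1, by omega⟩
  have hx : ∏ j ∈ Finset.Icc 1 (r + 1), x (i - 1 + (j : ZMod n)) =
      x i * ∏ j ∈ Finset.Icc 1 r, x (i + (j : ZMod n)) := by
    have h := prod_Icc_shift x i 0 r
    rw [zero_add] at h
    rw [h, ← Finset.mul_prod_Ioc_eq_prod_Icc (Nat.zero_le _), Nat.cast_zero, add_zero]
    rfl
  have hy : (∏ j ∈ Finset.Icc (r + 1 + 1 + 1) n, y (i - 1 + (j : ZMod n))) * y i =
      ∏ j ∈ Finset.Icc (r + 1 + 1) n, y (i + (j : ZMod n)) := by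
    rw [← prod_Icc_shift y i (r + 1 + 1) n, Finset.prod_Icc_succ_top (by omega)]
    have hz : i - 1 + ((n + 1 : ℕ) : ZMod n) = i := by
      push_cast
      rw [ZMod.natCast_self]
      ring
    rw [hz]
  simp only [geomQTerm, Nat.add_sub_cancel]
  rw [hx, ← hy]
  ring

theorem mul_geomQTerm_last (x y : ZMod n → ℝ) (i : ZMod n) :
    x i * geomQTerm x y i n = ∏ j, x j := by
  have h5 : Finset.Icc (n + 1) n = ∅ := by simp
  have e := prod_shift x i
  obtain ⟨r, hr⟩ : ∃ r, n = r + 1 := ⟨n - 1, by have := NeZero.ne n; omega⟩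
  have hI : Finset.Icc 1 n = insert n (Finset.Icc 1 (n - 1)) := by
    ext j
    simp only [Finset.mem_insert, Finset.mem_Icc]
    omega
  rw [hI, Finset.prod_insert (by simp only [Finset.mem_Icc]; omega)] at e
  simpa [geomQTerm, h5] using e

theorem mul_geomQTerm_first (x y : ZMod n → ℝ) (i : ZMod n) :
    y i * geomQTerm x y (i - 1) 1 = ∏ j, y j := by
  have e := prod_shift y (i - 1)
  have hI : Finset.Icc 1 n = insert 1 (Finset.Icc (1 + 1) n) := by
    have := NeZero.ne n
    ext j
    simp only [Finset.mem_insert, Finset.mem_Icc]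
    omega
  rw [hI, Finset.prod_insert (by simp)] at e
  simpa [geomQTerm] using e

/-- The `k`-th term on the left cancels the `(k + 1)`-st on the right by `mul_geomQTerm`; only the
last term, `∏ x`, and the first, `∏ y`, survive. -/
theorem geomQ_rec (x y : ZMod n → ℝ) (i : ZMod n) :
    x i * geomQ x y i - y i * geomQ x y (i - 1) = ∏ j, x j - ∏ j, y j := by
  have hn := NeZero.ne n
  have h1 : x i * geomQ x y i =
      ∑ k ∈ Finset.Ico 1 n, x i * geomQTerm x y i k + ∏ j, x j := by
    have hI : Finset.Icc 1 n = insert n (Finset.Ico 1 n) := by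
      ext j
      simp only [Finset.mem_insert, Finset.mem_Icc, Finset.mem_Ico]
      omega
    rw [geomQ, hI, Finset.sum_insert (by simp), mul_add, mul_geomQTerm_last, Finset.mul_sum,
      add_comm]
  have h2 : y i * geomQ x y (i - 1) =
      ∏ j, y j + ∑ k ∈ Finset.Ico 1 n, y i * geomQTerm x y (i - 1) (k + 1) := by
    have hI : Finset.Icc 1 n = insert 1 (Finset.Ico (1 + 1) (n + 1)) := by
      ext j
      simp only [Finset.mem_insert, Finset.mem_Icc, Finset.mem_Ico]
      omega
    rw [geomQ, hI, Finset.sum_insert (by simp), mul_add, mul_geomQTerm_first, Finset.mul_sum]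
    rw [← Finset.sum_Ico_add' (fun k => y i * geomQTerm x y (i - 1) k)]
  have h3 : ∑ k ∈ Finset.Ico 1 n, x i * geomQTerm x y i k =
      ∑ k ∈ Finset.Ico 1 n, y i * geomQTerm x y (i - 1) (k + 1) :=
    Finset.sum_congr rfl fun k hk => by
      rw [Finset.mem_Ico] at hk
      exact mul_geomQTerm x y i k hk.1 hk.2
  rw [h1, h2, h3]
  ring

/-- `geomQ` is the only solution of its recursion if the levels are different. -/
theorem eq_geomQ {x y q : ZMod n → ℝ} (hne : ∏ j, x j ≠ ∏ j, y j)
    (hq : ∀ i, x i * q i - y i * q (i - 1) = ∏ j, x j - ∏ j, y j) : q = geomQ x y := by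
  funext i
  -- The difference `d` of two solutions satisfies `x i * d i = y i * d (i - 1)`. Once around the
  -- cycle this yields `d i * ∏ x = d i * ∏ y`.
  have hd : ∀ k : ℕ, (q (i + k) - geomQ x y (i + k)) * ∏ j ∈ Finset.Icc 1 k, x (i + (j : ZMod n)) =
      (q i - geomQ x y i) * ∏ j ∈ Finset.Icc 1 k, y (i + (j : ZMod n)) := by
    intro k
    induction k with
    | zero => simp
    | succ k ih =>
      rw [Finset.prod_Icc_succ_top (by omega), Finset.prod_Icc_succ_top (by omega)]
      have e1 := hq (i + ((k + 1 : ℕ) : ZMod n))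
      have e2 := geomQ_rec x y (i + ((k + 1 : ℕ) : ZMod n))
      have e3 : i + ((k + 1 : ℕ) : ZMod n) - 1 = i + (k : ZMod n) := by
        push_cast
        ring
      rw [e3] at e1 e2
      linear_combination (y (i + ((k + 1 : ℕ) : ZMod n))) * ih +
        (∏ j ∈ Finset.Icc 1 k, x (i + (j : ZMod n))) * (e1 - e2)
  have h := hd n
  rw [prod_shift, prod_shift, ZMod.natCast_self, add_zero] at h
  have h' : (q i - geomQ x y i) * (∏ j, x j - ∏ j, y j) = 0 := by linear_combination h
  rcases mul_eq_zero.1 h' with h0 | h0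
  · exact sub_eq_zero.1 h0
  · exact absurd (sub_eq_zero.1 h0) hne

/-- The geometric lift of `x̃` in `R : x ⊗ y ↦ ỹ ⊗ x̃`. -/
noncomputable def geomRFst (x y : ZMod n → ℝ) (i : ZMod n) : ℝ :=
  x i * geomQ x y i / geomQ x y (i - 1)

/-- The geometric lift of `ỹ` in `R : x ⊗ y ↦ ỹ ⊗ x̃`. -/
noncomputable def geomRSnd (x y : ZMod n → ℝ) (i : ZMod n) : ℝ :=
  y i * geomQ x y (i - 1) / geomQ x y i

/-- The geometric lift of `x̃` in `R^∨ : x ⊗ y ↦ ỹ ⊗ x̃`; by symmetry, `ỹ` is lifted by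
`geomV y x`. -/
noncomputable def geomV (x y : ZMod n → ℝ) (i : ZMod n) : ℝ :=
  x i * (x (i + 1) + y (i + 1)) / (x i + y i)

section Positivity

variable {x y : ZMod n → ℝ} (hx : ∀ i, 0 < x i) (hy : ∀ i, 0 < y i)
include hx hy

theorem geomRFst_pos (i : ZMod n) : 0 < geomRFst x y i :=
  div_pos (mul_pos (hx i) (geomQ_pos hx hy i)) (geomQ_pos hx hy _)

theorem geomRSnd_pos (i : ZMod n) : 0 < geomRSnd x y i :=
  div_pos (mul_pos (hy i) (geomQ_pos hx hy _)) (geomQ_pos hx hy _)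

theorem geomV_pos (i : ZMod n) : 0 < geomV x y i :=
  div_pos (mul_pos (hx i) (add_pos (hx _) (hy _))) (add_pos (hx _) (hy _))

/-- The factors `geomQ` cancel around the cycle. Levels thus survive every map below, and with them
the assumption that they differ. -/
theorem prod_geomRFst : ∏ i, geomRFst x y i = ∏ i, x i := by
  have h : (∏ i, geomQ x y i) ≠ 0 := (Finset.prod_pos fun i _ => geomQ_pos hx hy i).ne'
  simp only [geomRFst, Finset.prod_div_distrib, Finset.prod_mul_distrib, prod_pred]
  exact mul_div_cancel_right₀ _ h

theorem prod_geomRSnd : ∏ i, geomRSnd x y i = ∏ i, y i := by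
  have h : (∏ i, geomQ x y i) ≠ 0 := (Finset.prod_pos fun i _ => geomQ_pos hx hy i).ne'
  simp only [geomRSnd, Finset.prod_div_distrib, Finset.prod_mul_distrib, prod_pred]
  exact mul_div_cancel_right₀ _ h

theorem prod_geomV : ∏ i, geomV x y i = ∏ i, x i := by
  have h : (∏ i, (x i + y i)) ≠ 0 := (Finset.prod_pos fun i _ => add_pos (hx i) (hy i)).ne'
  simp only [geomV, Finset.prod_div_distrib, Finset.prod_mul_distrib]
  rw [prod_succ fun i => x i + y i]
  exact mul_div_cancel_right₀ _ h

theorem geomR_mul (i : ZMod n) : geomRSnd x y i * geomRFst x y i = x i * y i := by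
  have h1 := (geomQ_pos hx hy i).ne'
  have h2 := (geomQ_pos hx hy (i - 1)).ne'
  simp only [geomRFst, geomRSnd]
  field_simp

/-- The recursions at `i` and `i + 1` have the same right-hand side. With `geomR_mul` this matches
all coefficients in `lax_comm`. -/
theorem geomR_add (i : ZMod n) :
    geomRSnd x y i + geomRFst x y (i + 1) = x i + y (i + 1) := by
  have h1 := (geomQ_pos hx hy i).ne'
  have e1 := geomQ_rec x y i
  have e2 := geomQ_rec x y (i + 1)
  rw [add_sub_cancel_right] at e2
  simp only [geomRFst, geomRSnd, add_sub_cancel_right]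
  field_simp
  linear_combination e2 - e1

theorem geomV_add (i : ZMod n) : geomV x y i + geomV y x i = x (i + 1) + y (i + 1) := by
  have h1 := (add_pos (hx i) (hy i)).ne'
  have h2 := (add_pos (hy i) (hx i)).ne'
  simp only [geomV]
  field_simp
  ring

end Positivity

end GeometricR

/-! ### Lax operators and uniqueness of their factorizations -/

section Lax

variable {n : ℕ} [NeZero n]

/-- The Lax operator of `x` on sequences: diagonal part `x` minus the shift. -/
def lax (x : ZMod n → ℝ) (v : ℕ → ℝ) (k : ℕ) : ℝ := x (k : ZMod n) * v k - v (k + 1)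

theorem lax_comm {x y : ZMod n → ℝ} (hx : ∀ i, 0 < x i) (hy : ∀ i, 0 < y i) (v : ℕ → ℝ) :
    lax (geomRSnd x y) (lax (geomRFst x y) v) = lax x (lax y v) := by
  funext k
  have h1 := geomR_mul hx hy (k : ZMod n)
  have h2 := geomR_add hx hy (k : ZMod n)
  simp only [lax, Nat.cast_add, Nat.cast_one]
  linear_combination v k * h1 - v (k + 1) * h2

theorem lax_quasiperiodic (x : ZMod n → ℝ) {v : ℕ → ℝ} {z : ℝ}
    (hv : ∀ k, v (k + n) = z * v k) (k : ℕ) : lax x v (k + n) = z * lax x v k := by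
  have h := hv (k + 1)
  rw [show k + 1 + n = k + n + 1 by ring] at h
  simp only [lax, Nat.cast_add, ZMod.natCast_self, add_zero, hv, h]
  ring

theorem iterate_prod {x : ZMod n → ℝ} {v : ℕ → ℝ}
    (hv : ∀ k : ℕ, v (k + 1) = x (k : ZMod n) * v k) (k : ℕ) :
    v (k + n) = (∏ i, x i) * v k := by
  have h : ∀ r : ℕ, v (k + r) =
      (∏ j ∈ Finset.Icc 1 r, x ((k : ZMod n) - 1 + (j : ZMod n))) * v k := by
    intro r
    induction r with
    | zero => simp
    | succ r ih =>
      rw [Finset.prod_Icc_succ_top (by omega), ← add_assoc, hv, ih]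
      have e : (k : ZMod n) - 1 + ((r + 1 : ℕ) : ZMod n) = ((k + r : ℕ) : ZMod n) := by
        push_cast
        ring
      rw [e]
      ring
  rw [h n, prod_shift]

/-- A sequence killed by `lax x` is multiplied by `∏ x` over each period, which conflicts with
another multiplier `z` unless it vanishes. -/
theorem eq_zero_of_lax_eq_zero {x : ZMod n → ℝ} {v : ℕ → ℝ} {z : ℝ}
    (hv : ∀ k, v (k + n) = z * v k) (hz : ∏ i, x i ≠ z) (h : ∀ k, lax x v k = 0) (k : ℕ) :
    v k = 0 := by
  have e := iterate_prod (x := x) (v := v) (fun k => by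
    have := h k
    simp only [lax] at this
    linarith) k
  rw [hv k] at e
  have : (∏ i, x i - z) * v k = 0 := by linear_combination -e
  exact (mul_eq_zero.1 this).resolve_left (sub_ne_zero.2 hz)

/-- Allows the innermost factor of a composition to be cancelled. -/
theorem lax_surjective (x : ZMod n → ℝ) (v : ℕ → ℝ) : ∃ t, lax x t = v := by
  refine ⟨fun k => Nat.rec 0 (fun k t => x (k : ZMod n) * t - v k) k, ?_⟩
  funext k
  simp [lax]

theorem exists_lax_kernel {x : ZMod n → ℝ} (hx : ∀ i, 0 < x i) :
    ∃ v : ℕ → ℝ, (∀ k, 0 < v k) ∧ (∀ k, lax x v k = 0) ∧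
      ∀ k, v (k + n) = (∏ i, x i) * v k := by
  have h : ∀ k : ℕ, ∏ j ∈ Finset.range (k + 1), x (j : ZMod n) =
      x (k : ZMod n) * ∏ j ∈ Finset.range k, x (j : ZMod n) := fun k => by
    rw [Finset.prod_range_succ, mul_comm]
  exact ⟨fun k => ∏ j ∈ Finset.range k, x (j : ZMod n),
    fun k => Finset.prod_pos fun _ _ => hx _,
    fun k => sub_eq_zero.2 (h k).symm,
    iterate_prod (v := fun k => ∏ j ∈ Finset.range k, x (j : ZMod n)) h⟩

theorem eq_of_lax_kernel {x y : ZMod n → ℝ} {v : ℕ → ℝ} (hv : ∀ k, 0 < v k)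
    (hx : ∀ k, lax x v k = 0) (hy : ∀ k, lax y v k = 0) : x = y := by
  funext i
  have h1 := hx i.val
  have h2 := hy i.val
  simp only [lax, ZMod.natCast_zmod_val] at h1 h2
  exact mul_right_cancel₀ (hv i.val).ne' (by linarith)

/-- A product of two Lax operators determines the factors, given their different levels. -/
theorem lax_factor_two {a b a' b' : ZMod n → ℝ} (ha' : ∀ i, 0 < a' i)
    (hab : ∏ i, b i ≠ ∏ i, a' i) (h : ∀ v, lax b (lax a v) = lax b' (lax a' v)) :
    a = a' ∧ b = b' := by
  -- Test on the positive kernel vector of `a'`: its image under `lax a` has multiplier `∏ a'` and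
  -- is killed by `lax b`, so it vanishes. A positive kernel vector determines the array.
  obtain ⟨v, hv, h0, hp⟩ := exists_lax_kernel ha'
  have ha : a = a' := by
    refine eq_of_lax_kernel hv ?_ h0
    refine eq_zero_of_lax_eq_zero (lax_quasiperiodic a hp) hab fun k => ?_
    rw [h v]
    have h1 : lax a' v = 0 := funext h0
    rw [h1]
    simp [lax]
  subst ha
  refine ⟨rfl, funext fun i => ?_⟩
  obtain ⟨t, ht⟩ := lax_surjective a fun _ => 1
  have h1 := congrFun (h t) i.val
  rw [ht] at h1
  simpa [lax] using h1

/-- A product of three Lax operators determines the factors, given their different levels. -/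
theorem lax_factor_three {a b c a' b' c' : ZMod n → ℝ} (ha' : ∀ i, 0 < a' i)
    (hb' : ∀ i, 0 < b' i) (hba : ∏ i, b i ≠ ∏ i, a' i) (hca : ∏ i, c i ≠ ∏ i, a' i)
    (hcb : ∏ i, c i ≠ ∏ i, b' i)
    (h : ∀ v, lax c (lax b (lax a v)) = lax c' (lax b' (lax a' v))) :
    a = a' ∧ b = b' ∧ c = c' := by
  obtain ⟨v, hv, h0, hp⟩ := exists_lax_kernel ha'
  have ha : a = a' := by
    refine eq_of_lax_kernel hv ?_ h0
    refine eq_zero_of_lax_eq_zero (lax_quasiperiodic a hp) hba fun k => ?_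
    refine eq_zero_of_lax_eq_zero (lax_quasiperiodic b (lax_quasiperiodic a hp)) hca
      (fun k => ?_) k
    rw [h v]
    have h1 : lax a' v = 0 := funext h0
    rw [h1]
    simp [lax]
  subst ha
  refine ⟨rfl, lax_factor_two hb' hcb fun v => ?_⟩
  obtain ⟨t, rfl⟩ := lax_surjective a v
  exact h t

end Lax

/-! ### Yang–Baxter equations for the rational lifts -/

section GeometricYangBaxter

variable {n : ℕ} [NeZero n] {x y w : ZMod n → ℝ}

theorem geomR_yangBaxter (hx : ∀ i, 0 < x i) (hy : ∀ i, 0 < y i) (hw : ∀ i, 0 < w i)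
    (hxy : ∏ i, x i ≠ ∏ i, y i) (hxw : ∏ i, x i ≠ ∏ i, w i) (hyw : ∏ i, y i ≠ ∏ i, w i) :
    let a := geomRFst x y
    let b := geomRSnd x y
    let w' := geomRSnd a w
    let ŷ := geomRFst y w
    let ŵ := geomRSnd y w
    let x' := geomRFst x ŵ
    geomRFst a w = geomRFst x' ŷ ∧ geomRFst b w' = geomRSnd x' ŷ ∧
      geomRSnd b w' = geomRSnd x ŵ := by
  intro a b w' ŷ ŵ x'
  have ha := geomRFst_pos hx hy
  have hb := geomRSnd_pos hx hy
  have hw' := geomRSnd_pos ha hw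
  have hŷ := geomRFst_pos hy hw
  have hŵ := geomRSnd_pos hy hw
  have hx' := geomRFst_pos hx hŵ
  -- Both sides factor `lax x ∘ lax y ∘ lax w`, with the levels in the same order.
  refine lax_factor_three (geomRFst_pos hx' hŷ) (geomRSnd_pos hx' hŷ) ?_ ?_ ?_ fun v => ?_
  · rw [prod_geomRFst hb hw', prod_geomRSnd hx hy, prod_geomRFst hx' hŷ, prod_geomRFst hx hŵ]
    exact hxy.symm
  · rw [prod_geomRSnd hb hw', prod_geomRSnd ha hw, prod_geomRFst hx' hŷ, prod_geomRFst hx hŵ]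
    exact hxw.symm
  · rw [prod_geomRSnd hb hw', prod_geomRSnd ha hw, prod_geomRSnd hx' hŷ, prod_geomRFst hy hw]
    exact hyw.symm
  · rw [lax_comm hb hw', lax_comm ha hw, lax_comm hx hy, lax_comm hx' hŷ, lax_comm hx hŵ,
      lax_comm hy hw]

/-- Lets any explicit solution of the recursion replace `geomQ`. -/
theorem geomR_eq_of_rec {q : ZMod n → ℝ} (hne : ∏ j, x j ≠ ∏ j, y j)
    (hq : ∀ i, x i * q i - y i * q (i - 1) = ∏ j, x j - ∏ j, y j) (i : ZMod n) :
    geomRFst x y i = x i * q i / q (i - 1) ∧ geomRSnd x y i = y i * q (i - 1) / q i := by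
  rw [geomRFst, geomRSnd, ← eq_geomQ hne hq]
  exact ⟨rfl, rfl⟩

theorem geomV_yangBaxter (hx : ∀ i, 0 < x i) (hy : ∀ i, 0 < y i) (hw : ∀ i, 0 < w i)
    (hxy : ∏ i, x i ≠ ∏ i, y i) :
    let a := geomRFst x y
    let b := geomRSnd x y
    let w' := geomV w a
    let ŷ := geomV y w
    let ŵ := geomV w y
    let x' := geomV x ŵ
    geomV a w = geomRFst x' ŷ ∧ geomV b w' = geomRSnd x' ŷ ∧ geomV w' b = geomV ŵ x := by
  intro a b w' ŷ ŵ x'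
  have ha : ∀ i, 0 < a i := geomRFst_pos hx hy
  have hb : ∀ i, 0 < b i := geomRSnd_pos hx hy
  have hw' : ∀ i, 0 < w' i := geomV_pos hw ha
  have hŷ : ∀ i, 0 < ŷ i := geomV_pos hy hw
  have hŵ : ∀ i, 0 < ŵ i := geomV_pos hw hy
  have hx' : ∀ i, 0 < x' i := geomV_pos hx hŵ
  have hQ := geomQ_pos hx hy
  set Δ := ∏ j, x j - ∏ j, y j with hΔ
  set N : ZMod n → ℝ := fun i => x i + ŵ i with hNd
  set p : ZMod n → ℝ := fun i => y i + w i with hpd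
  set N' : ZMod n → ℝ := fun i => b i + w' i with hNd'
  set p' : ZMod n → ℝ := fun i => a i + w i with hpd'
  have hN : ∀ i, 0 < N i := fun i => add_pos (hx i) (hŵ i)
  have hp : ∀ i, 0 < p i := fun i => add_pos (hy i) (hw i)
  have hN' : ∀ i, 0 < N' i := fun i => add_pos (hb i) (hw' i)
  have hp' : ∀ i, 0 < p' i := fun i => add_pos (ha i) (hw i)
  have eŷ : ∀ i, ŷ i * p i = y i * p (i + 1) := fun i => div_mul_cancel₀ _ (hp i).ne'
  have eŵ : ∀ i, ŵ i * p i = w i * p (i + 1) := fun i => by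
    simp only [ŵ, geomV, p]
    rw [add_comm (y i), div_mul_cancel₀ _ (add_pos (hw i) (hy i)).ne', add_comm (w (i + 1))]
  have ex' : ∀ i, x' i * N i = x i * N (i + 1) := fun i => div_mul_cancel₀ _ (hN i).ne'
  have ew' : ∀ i, w' i * p' i = w i * p' (i + 1) := fun i => by
    simp only [w', geomV, p']
    rw [add_comm (a i), div_mul_cancel₀ _ (add_pos (hw i) (ha i)).ne', add_comm (w (i + 1))]
  -- the products `N p` are invariant under `R`
  have hNp : ∀ i, N i * p i = N' i * p' i := by
    intro i
    have h1 := geomR_mul hx hy i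
    have h2 := geomR_add hx hy i
    have e1 := eŵ i
    have e2 := ew' i
    simp only [hNd, hpd, hNd', hpd'] at e1 e2 ⊢
    -- Expanded, `N i * p i` is `x i * y i + w i * (x i + y (i + 1) + w (i + 1))`, which involves
    -- `x` and `y` only through the two invariants in `geomR_mul` and `geomR_add`.
    linear_combination e1 - e2 - h1 - w i * h2
  have hsum : ∀ i, ŷ i + ŵ i = p (i + 1) := geomV_add hy hw
  -- An explicit solution of the recursion for `x'` and `ŷ`. By `hpQ` below its numerator is `geomQ
  -- x y i * p' (i + 1)`.
  have hq : ∀ i, x' i * ((p (i + 1) * geomQ x y i + Δ) / N (i + 1)) -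
      ŷ i * ((p (i - 1 + 1) * geomQ x y (i - 1) + Δ) / N (i - 1 + 1)) = Δ := by
    intro i
    have h1 := (hN i).ne'
    have h2 := (hN (i + 1)).ne'
    rw [sub_add_cancel]
    have e1 : x' i = x i * N (i + 1) / N i := rfl
    rw [e1]
    field_simp
    have e2 := geomQ_rec x y i
    have e3 : N i = x i + ŵ i := rfl
    linear_combination (-geomQ x y (i - 1)) * eŷ i + p (i + 1) * e2 - Δ * hsum i - Δ * e3
  have hlev : ∏ j, x' j - ∏ j, ŷ j = Δ := by rw [prod_geomV hx hŵ, prod_geomV hy hw]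
  have hne : ∏ j, x' j ≠ ∏ j, ŷ j := by rwa [prod_geomV hx hŵ, prod_geomV hy hw]
  have hR := fun i => geomR_eq_of_rec (q := fun i => (p (i + 1) * geomQ x y i + Δ) / N (i + 1)) hne
    (fun i => (hq i).trans hlev.symm) i
  have hpQ : ∀ i, p (i + 1) * geomQ x y i + Δ = geomQ x y i * p' (i + 1) := by
    intro i
    have e1 := geomQ_rec x y (i + 1)
    have e2 : a (i + 1) * geomQ x y i = x (i + 1) * geomQ x y (i + 1) := by
      simp only [a, geomRFst, add_sub_cancel_right]
      exact div_mul_cancel₀ _ (hQ i).ne'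
    rw [add_sub_cancel_right] at e1
    simp only [hpd, hpd']
    linear_combination -e1 - e2
  have hpQ' : ∀ i, p i * geomQ x y (i - 1) + Δ = geomQ x y (i - 1) * p' i := fun i => by
    simpa using hpQ (i - 1)
  simp only [hpQ, sub_add_cancel, hpQ'] at hR
  have va : ∀ i, geomV a w i = a i * p' (i + 1) / p' i := fun i => rfl
  have vb : ∀ i, geomV b w' i = b i * N' (i + 1) / N' i := fun i => rfl
  have vw : ∀ i, geomV w' b i = w' i * N' (i + 1) / N' i := fun i => by
    simp only [geomV, N', add_comm]
  have vŵ : ∀ i, geomV ŵ x i = ŵ i * N (i + 1) / N i := fun i => by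
    simp only [geomV, N, add_comm]
  have ua : ∀ i, a i = x i * geomQ x y i / geomQ x y (i - 1) := fun i => rfl
  have ub : ∀ i, b i = y i * geomQ x y (i - 1) / geomQ x y i := fun i => rfl
  have hNp' : ∀ i, N i = N' i * p' i / p i := fun i => by
    rw [← hNp]
    exact (mul_div_cancel_right₀ _ (hp i).ne').symm
  -- From here on only the product relations are needed; opaque names keep `field_simp` from
  -- expanding them.
  clear_value N p N' p' a b w' ŷ ŵ x'
  refine ⟨funext fun i => ?_, funext fun i => ?_, funext fun i => ?_⟩
  · have h1 := (hN i).ne'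
    have h2 := (hN (i + 1)).ne'
    have h3 := (hp' i).ne'
    have h4 := (hQ (i - 1)).ne'
    rw [(hR i).1, va, ua, eq_div_of_mul_eq h1 (ex' i)]
    field_simp
  · have h2 := (hp (i + 1)).ne'
    have h3 := (hp' i).ne'
    have h4 := (hQ i).ne'
    have h5 := (hp i).ne'
    have h6 := (hp' (i + 1)).ne'
    have h7 := (hN' i).ne'
    rw [(hR i).2, vb, ub, eq_div_of_mul_eq h5 (eŷ i), hNp', hNp']
    field_simp
  · have h2 := (hp (i + 1)).ne'
    have h3 := (hp' i).ne'
    have h5 := (hp i).ne'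
    have h7 := (hN' i).ne'
    rw [vw, vŵ, hNp', hNp', eq_div_of_mul_eq h3 (ew' i), eq_div_of_mul_eq h5 (eŵ i)]
    field_simp

end GeometricYangBaxter

/-! ### The reflection equation for the rational lifts -/

section GeometricReflection

variable {n : ℕ} [NeZero n] {x y : ZMod n → ℝ}

/-- The geometric reflection equation for an index map `σ`. -/
def GeomReflection (σ : ZMod n → ZMod n) (x y : ZMod n → ℝ) : Prop :=
  (∀ i, geomRFst (geomV x (y ∘ σ) ∘ σ) (geomV (y ∘ σ) x) i =
    geomV (geomRFst x y ∘ σ) (geomRSnd x y) i) ∧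
  ∀ i, geomRSnd (geomV x (y ∘ σ) ∘ σ) (geomV (y ∘ σ) x) i =
    geomV (geomRSnd x y) (geomRFst x y ∘ σ) (σ i)

/-- For the rotation, the denominators `p i = x i + y (i + 1)` of `geomV` are exactly the sums that
`R` preserves by `geomR_add`. -/
theorem geomReflection_succ (hx : ∀ i, 0 < x i) (hy : ∀ i, 0 < y i)
    (hxy : ∏ i, x i ≠ ∏ i, y i) : GeomReflection (fun i => i + 1) x y := by
  set p : ZMod n → ℝ := fun i => x i + y (i + 1) with hpd
  have hp : ∀ i, p i ≠ 0 := fun i => (add_pos (hx i) (hy _)).ne'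
  have hQ := fun i => (geomQ_pos hx hy i).ne'
  have hyσ : ∀ i, 0 < (y ∘ fun i => i + 1) i := fun i => hy _
  have e1 : ∀ i, (geomV x (y ∘ fun i => i + 1) ∘ fun i => i + 1) i =
      x (i + 1) * p (i + 1 + 1) / p (i + 1) := fun i => rfl
  have e2 : ∀ i, geomV (y ∘ fun i => i + 1) x i = y (i + 1) * p (i + 1) / p i := fun i => by
    simp only [geomV, p, Function.comp, add_comm (x _)]
  have l1 : ∏ i, (geomV x (y ∘ fun i => i + 1) ∘ fun i => i + 1) i = ∏ i, x i :=
    (prod_succ _).trans (prod_geomV hx hyσ)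
  have l2 : ∏ i, geomV (y ∘ fun i => i + 1) x i = ∏ i, y i :=
    (prod_geomV hyσ hx).trans (prod_succ y)
  have hR := geomR_eq_of_rec (x := geomV x (y ∘ fun i => i + 1) ∘ fun i => i + 1)
    (y := geomV (y ∘ fun i => i + 1) x)
    (q := fun i => geomQ x y (i + 1) * p (i + 1) / p (i + 1 + 1)) (by rwa [l1, l2]) (fun i => by
      rw [l1, l2, e1, e2, ← geomQ_rec x y (i + 1), add_sub_cancel_right, sub_add_cancel]
      have h1 := hp i
      have h2 := hp (i + 1)
      have h3 := hp (i + 1 + 1)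
      field_simp)
  have hp' : ∀ i, geomRSnd x y i + geomRFst x y (i + 1) = p i := geomR_add hx hy
  have hp'' : ∀ i, geomRFst x y (i + 1) + geomRSnd x y i = p i := fun i => by rw [add_comm, hp']
  refine ⟨fun i => ?_, fun i => ?_⟩
  · rw [(hR i).1, e1]
    have h1 := hp i
    have h2 := hp (i + 1)
    have h3 := hp (i + 1 + 1)
    have h4 := hQ i
    simp only [geomV, Function.comp, hp'']
    simp only [geomRFst, sub_add_cancel, add_sub_cancel_right]
    field_simp
  · rw [(hR i).2, e2]
    have h1 := hp i
    have h2 := hp (i + 1)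
    have h3 := hp (i + 1 + 1)
    have h4 := hQ (i + 1)
    simp only [geomV, Function.comp, hp']
    simp only [geomRSnd, sub_add_cancel, add_sub_cancel_right]
    field_simp

/-- The case of an involution that exchanges `i` and `i + 1` for `i` in a set `E` of
representatives of one parity. -/
theorem geomReflection_switch {σ : ZMod n → ZMod n} (hσ : Function.Involutive σ)
    (E : ZMod n → Prop) (hE : ∀ i, E (i + 1) ↔ ¬ E i) (hσE : ∀ i, E i → σ i = i + 1)
    (hx : ∀ i, 0 < x i) (hy : ∀ i, 0 < y i)
    (hxy : ∏ i, x i ≠ ∏ i, y i) : GeomReflection σ x y := by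
  classical
  have hσ' : ∀ i, E i → σ (i + 1) = i := fun i hi => by rw [← hσE i hi, hσ]
  have hE2 : ∀ i, E i → E (i + 1 + 1) := fun i hi => by rw [hE, hE]; exact not_not.2 hi
  have hEp : ∀ i, E i → ¬ E (i - 1) := fun i hi => by rw [← hE, sub_add_cancel]; exact hi
  have key : ∀ C : ZMod n → Prop, (∀ i, E i → C i) → (∀ i, E i → C (i + 1)) → ∀ i, C i := by
    intro C h1 h2 i
    by_cases hi : E i
    · exact h1 i hi
    · have h := h2 (i - 1) (by rw [← not_not (a := E (i - 1)), ← hE, sub_add_cancel]; exact hi)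
      rwa [sub_add_cancel] at h
  set p : ZMod n → ℝ := fun i => x i + y (σ i) with hpd
  set a := geomRFst x y with had
  set b := geomRSnd x y with hbd
  set p' : ZMod n → ℝ := fun i => b i + a (σ i) with hpd'
  have hp : ∀ i, 0 < p i := fun i => add_pos (hx i) (hy _)
  have hQ := fun i => geomQ_pos hx hy i
  have hyσ : ∀ i, 0 < (y ∘ σ) i := fun i => hy _
  have e1 : ∀ i, (geomV x (y ∘ σ) ∘ σ) i = x (σ i) * p (σ i + 1) / p (σ i) := fun i => rfl
  have e2 : ∀ i, geomV (y ∘ σ) x i = y (σ i) * p (i + 1) / p i := fun i => by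
    simp only [geomV, p, Function.comp, add_comm (x _)]
  have e3 : ∀ i, geomV (a ∘ σ) b i = a (σ i) * p' (i + 1) / p' i := fun i => by
    simp only [geomV, p', Function.comp, add_comm (b _)]
  have e4 : ∀ i, geomV b (a ∘ σ) i = b i * p' (i + 1) / p' i := fun i => rfl
  have l1 : ∏ i, (geomV x (y ∘ σ) ∘ σ) i = ∏ i, x i :=
    (Equiv.prod_comp hσ.toPerm _).trans (prod_geomV hx hyσ)
  have l2 : ∏ i, geomV (y ∘ σ) x i = ∏ i, y i :=
    (prod_geomV hyσ hx).trans (Equiv.prod_comp hσ.toPerm y)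
  have hpE : ∀ i, E i → p' i = p i := fun i hi => by
    simp only [p, p', hσE i hi]
    exact geomR_add hx hy i
  have hp0 : ∀ i, E i → p i = x i + y (i + 1) := fun i hi => by simp only [p, hσE i hi]
  have hp1 : ∀ i, E i → p (i + 1) = x (i + 1) + y i := fun i hi => by simp only [p, hσ' i hi]
  have hp1' : ∀ i, E i → p' (i + 1) = b (i + 1) + a i := fun i hi => by simp only [p', hσ' i hi]
  have hae : ∀ i, a i = x i * geomQ x y i / geomQ x y (i - 1) := fun i => rfl
  have hbe : ∀ i, b i = y i * geomQ x y (i - 1) / geomQ x y i := fun i => rfl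
  have hrec := geomQ_rec x y
  -- Outside `E` the solution keeps the old `geomQ`; the recursion at `i` in `E` then forces the
  -- value there, and the recursion at `i + 1` is consistent with it.
  set q : ZMod n → ℝ := fun i => if E i then
    (geomQ x y (i - 1) * y (i + 1) + geomQ x y (i + 1) * x i) * p (i + 1) /
      (p i * p (i + 1 + 1)) else geomQ x y i with hqd
  have hqE : ∀ i, E i → q i = (geomQ x y (i - 1) * y (i + 1) + geomQ x y (i + 1) * x i) *
      p (i + 1) / (p i * p (i + 1 + 1)) := fun i hi => if_pos hi
  have hqE' : ∀ i, ¬ E i → q i = geomQ x y i := fun i hi => if_neg hi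
  have hS : ∀ i, 0 < geomQ x y (i - 1) * y (i + 1) + geomQ x y (i + 1) * x i := fun i =>
    add_pos (mul_pos (hQ _) (hy _)) (mul_pos (hQ _) (hx _))
  clear_value p p' q a b
  have hR := geomR_eq_of_rec (x := geomV x (y ∘ σ) ∘ σ) (y := geomV (y ∘ σ) x)
    (q := q) (by rwa [l1, l2]) (key _ (fun i hi => by
      have r1 := hrec i
      have r2 := hrec (i + 1)
      rw [add_sub_cancel_right] at r2
      rw [l1, l2, e1, e2, hσE i hi, hqE i hi, hqE' (i - 1) (hEp i hi)]
      have h0 := hp0 i hi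
      have h1 := hp1 i hi
      have h2 := (hp (i + 1 + 1)).ne'
      have n0 := (hp i).ne'
      have n1 := (hp (i + 1)).ne'
      field_simp
      linear_combination x i * r2 + y (i + 1) * r1 -
        y (i + 1) * geomQ x y (i - 1) * h1 - (∏ j, x j - ∏ j, y j) * h0) (fun i hi => by
      have r1 := hrec i
      have r2 := hrec (i + 1)
      rw [add_sub_cancel_right] at r2
      rw [l1, l2, e1, e2, hσ' i hi, add_sub_cancel_right, hqE i hi,
        hqE' (i + 1) (by rw [hE]; exact not_not.2 hi)]
      have h0 := hp0 i hi
      have h1 := hp1 i hi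
      have h2 := (hp (i + 1 + 1)).ne'
      have n0 := (hp i).ne'
      have n1 := (hp (i + 1)).ne'
      field_simp
      linear_combination x i * r2 + y (i + 1) * r1 +
        x i * geomQ x y (i + 1) * h1 - (∏ j, x j - ∏ j, y j) * h0))
  -- Only at indices in `E` does `R` preserve the denominator (`hpE`). At the others the new
  -- denominator contains the same sum as `q`.
  have hP : ∀ i, E i → p' (i + 1) = geomQ x y i *
      (geomQ x y (i - 1) * y (i + 1) + geomQ x y (i + 1) * x i) /
        (geomQ x y (i + 1) * geomQ x y (i - 1)) := by
    intro i hi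
    have m0 := (hQ (i - 1)).ne'
    have m1 := (hQ i).ne'
    have m2 := (hQ (i + 1)).ne'
    rw [hp1' i hi, hae, hbe, add_sub_cancel_right]
    field_simp
  refine ⟨fun i => ?_, fun i => ?_⟩
  · rw [← had, ← hbd, (hR i).1]
    revert i
    refine key _ (fun i hi => ?_) (fun i hi => ?_)
    all_goals
      have h2 := (hp (i + 1 + 1)).ne'
      have n0 := (hp i).ne'
      have n1 := (hp (i + 1)).ne'
      have m0 := (hQ (i - 1)).ne'
      have m1 := (hQ i).ne'
      have m2 := (hQ (i + 1)).ne'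
      have s := (hS i).ne'
    · rw [e1, e3, hσE i hi, hpE i hi, hP i hi, hqE i hi, hqE' (i - 1) (hEp i hi), hae,
        add_sub_cancel_right]
      field_simp
    · rw [e1, e3, hσ' i hi, add_sub_cancel_right, hpE _ (hE2 i hi), hP i hi, hqE i hi,
        hqE' (i + 1) (by rw [hE]; exact not_not.2 hi), hae]
      field_simp
  · rw [← had, ← hbd, (hR i).2]
    revert i
    refine key _ (fun i hi => ?_) (fun i hi => ?_)
    all_goals
      have h2 := (hp (i + 1 + 1)).ne'
      have n0 := (hp i).ne'
      have n1 := (hp (i + 1)).ne'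
      have m0 := (hQ (i - 1)).ne'
      have m1 := (hQ i).ne'
      have m2 := (hQ (i + 1)).ne'
      have s := (hS i).ne'
    · rw [e2, e4, hσE i hi, hpE _ (hE2 i hi), hP i hi, hqE i hi, hqE' (i - 1) (hEp i hi), hbe,
        add_sub_cancel_right]
      field_simp
    · rw [e2, e4, hσ' i hi, add_sub_cancel_right, hpE i hi, hP i hi, hqE i hi,
        hqE' (i + 1) (by rw [hE]; exact not_not.2 hi), hbe]
      field_simp

theorem geomReflection (e : EndType n) (hx : ∀ i, 0 < x i) (hy : ∀ i, 0 < y i)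
    (hxy : ∏ i, x i ≠ ∏ i, y i) : GeomReflection e.perm x y := by
  cases e with
  | rotateLeft => exact geomReflection_succ hx hy hxy
  | switch1n h =>
    exact geomReflection_switch (swap1n_involutive h) (fun i => Even i.val)
      (even_val_add_one h) (fun i hi => if_pos hi) hx hy hxy
  | switch12 h =>
    exact geomReflection_switch (swap12_involutive h) (fun i => ¬ Even i.val)
      (fun i => not_congr (even_val_add_one h i)) (fun i hi => if_neg hi) hx hy hxy

end GeometricReflection

/-! ### Passage from rational maps to piecewise linear ones -/

section Tropicalization

/-- The positive sequence `f` decays like `2 ^ (- a s)`. -/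
def Trop (f : ℕ → ℝ) (a : ℕ) : Prop :=
  ∃ c C : ℝ, 0 < c ∧ 0 < C ∧ ∀ s : ℕ, c ≤ f s * 2 ^ (a * s) ∧ f s * 2 ^ (a * s) ≤ C

theorem Trop.pos {f : ℕ → ℝ} {a : ℕ} (h : Trop f a) (s : ℕ) : 0 < f s := by
  obtain ⟨c, C, hc, -, h⟩ := h
  exact pos_of_mul_pos_left (hc.trans_le (h s).1) (by positivity)

theorem Trop.mul {f g : ℕ → ℝ} {a b : ℕ} (hf : Trop f a) (hg : Trop g b) :
    Trop (fun s => f s * g s) (a + b) := by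
  have pf := hf.pos
  have pg := hg.pos
  obtain ⟨c, C, hc, hC, hf⟩ := hf
  obtain ⟨d, D, hd, hD, hg⟩ := hg
  refine ⟨c * d, C * D, mul_pos hc hd, mul_pos hC hD, fun s => ?_⟩
  have e : f s * g s * 2 ^ ((a + b) * s) = (f s * 2 ^ (a * s)) * (g s * 2 ^ (b * s)) := by ring
  have p2 : 0 ≤ g s * 2 ^ (b * s) := (mul_pos (pg s) (by positivity)).le
  rw [e]
  exact ⟨mul_le_mul (hf s).1 (hg s).1 hd.le (hc.le.trans (hf s).1),
    mul_le_mul (hf s).2 (hg s).2 p2 hC.le⟩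

theorem Trop.div {f g : ℕ → ℝ} {a b : ℕ} (hf : Trop f a) (hg : Trop g b) (hba : b ≤ a) :
    Trop (fun s => f s / g s) (a - b) := by
  have pg := hg.pos
  obtain ⟨c, C, hc, hC, hf⟩ := hf
  obtain ⟨d, D, hd, hD, hg⟩ := hg
  obtain ⟨r, rfl⟩ := Nat.exists_eq_add_of_le hba
  refine ⟨c / D, C / d, div_pos hc hD, div_pos hC hd, fun s => ?_⟩
  have e : f s / g s * 2 ^ ((b + r - b) * s) =
      (f s * 2 ^ ((b + r) * s)) / (g s * 2 ^ (b * s)) := by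
    rw [Nat.add_sub_cancel_left, add_mul, pow_add]
    have := (pg s).ne'
    field_simp
  have p2 : 0 < g s * 2 ^ (b * s) := mul_pos (pg s) (by positivity)
  rw [e]
  exact ⟨div_le_div₀ (hc.le.trans (hf s).1) (hf s).1 p2 (hg s).2,
    div_le_div₀ hC.le (hf s).2 hd (hg s).1⟩

/-- Positivity excludes cancellation, so the slower decay wins. -/
theorem Trop.add {f g : ℕ → ℝ} {a b : ℕ} (hf : Trop f a) (hg : Trop g b) :
    Trop (fun s => f s + g s) (min a b) := by
  have pf := hf.pos
  have pg := hg.pos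
  obtain ⟨c, C, hc, hC, hf⟩ := hf
  obtain ⟨d, D, hd, hD, hg⟩ := hg
  refine ⟨min c d, C + D, lt_min hc hd, add_pos hC hD, fun s => ?_⟩
  have h1 : f s * 2 ^ (min a b * s) ≤ f s * 2 ^ (a * s) :=
    mul_le_mul_of_nonneg_left (pow_le_pow_right₀ one_le_two
      (Nat.mul_le_mul_right s (min_le_left a b))) (pf s).le
  have h2 : g s * 2 ^ (min a b * s) ≤ g s * 2 ^ (b * s) :=
    mul_le_mul_of_nonneg_left (pow_le_pow_right₀ one_le_two
      (Nat.mul_le_mul_right s (min_le_right a b))) (pg s).le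
  have p1 : 0 < f s * 2 ^ (min a b * s) := mul_pos (pf s) (by positivity)
  have p2 : 0 < g s * 2 ^ (min a b * s) := mul_pos (pg s) (by positivity)
  rw [add_mul]
  refine ⟨?_, add_le_add (h1.trans (hf s).2) (h2.trans (hg s).2)⟩
  rcases min_choice a b with h | h <;> rw [h] at p1 p2 ⊢
  · exact (min_le_left c d).trans ((hf s).1.trans (le_add_of_nonneg_right p2.le))
  · exact (min_le_right c d).trans ((hg s).1.trans (le_add_of_nonneg_left p1.le))

theorem Trop.prod {ι : Type*} {f : ι → ℕ → ℝ} {a : ι → ℕ} (h : ∀ j, Trop (f j) (a j))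
    (t : Finset ι) : Trop (fun s => ∏ j ∈ t, f j s) (∑ j ∈ t, a j) := by
  classical
  induction t using Finset.induction_on with
  | empty => exact ⟨1, 1, one_pos, one_pos, fun s => by simp⟩
  | insert j t hj ih =>
    simp only [Finset.prod_insert hj, Finset.sum_insert hj]
    exact (h j).mul ih

theorem Trop.sum {ι : Type*} {f : ι → ℕ → ℝ} {a : ι → ℕ} (h : ∀ j, Trop (f j) (a j))
    {t : Finset ι} (ht : t.Nonempty) : Trop (fun s => ∑ j ∈ t, f j s) (t.inf' ht a) := by
  induction ht using Finset.Nonempty.cons_induction with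
  | singleton j => simpa using h j
  | cons j t hj ht ih =>
    simp only [Finset.sum_cons, Finset.inf'_cons ht]
    exact (h j).add ih

theorem Trop.le {f : ℕ → ℝ} {a b : ℕ} (ha : Trop f a) (hb : Trop f b) : b ≤ a := by
  by_contra! hab
  obtain ⟨c, C, hc, hC, ha⟩ := ha
  obtain ⟨d, D, hd, hD, hb⟩ := hb
  -- If `a < b`, rescaling by `2 ^ (b * s)` leaves at least `c * 2 ^ s`, which exceeds the bound `D`
  -- for this `s`.
  obtain ⟨s, hs⟩ := pow_unbounded_of_one_lt (D / c) one_lt_two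
  obtain ⟨r, rfl⟩ := Nat.exists_eq_add_of_lt hab
  have h1 : f s * 2 ^ ((a + r + 1) * s) = (f s * 2 ^ (a * s)) * (2 ^ (r * s) * 2 ^ s) := by ring
  have h2 : (1 : ℝ) ≤ 2 ^ (r * s) := one_le_pow₀ one_le_two
  have h3 := (hb s).2
  rw [h1] at h3
  rw [div_lt_iff₀ hc] at hs
  have h4 : (2 : ℝ) ^ s ≤ 2 ^ (r * s) * 2 ^ s := le_mul_of_one_le_left (by positivity) h2
  have h5 : c * 2 ^ s ≤ (f s * 2 ^ (a * s)) * (2 ^ (r * s) * 2 ^ s) :=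
    mul_le_mul (ha s).1 h4 (by positivity) (hc.le.trans (ha s).1)
  linarith

theorem Trop.unique {f : ℕ → ℝ} {a b : ℕ} (ha : Trop f a) (hb : Trop f b) : a = b :=
  le_antisymm (hb.le ha) (ha.le hb)

variable {n : ℕ} [NeZero n]

/-- The family `f s` of positive arrays has `X` as its array of decay exponents. -/
def TropArr (f : ℕ → ZMod n → ℝ) (X : ZMod n → ℕ) : Prop := ∀ i, Trop (fun s => f s i) (X i)

theorem TropArr.pos {f : ℕ → ZMod n → ℝ} {X : ZMod n → ℕ} (h : TropArr f X) (s : ℕ)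
    (i : ZMod n) : 0 < f s i :=
  (h i).pos s

theorem TropArr.comp {f : ℕ → ZMod n → ℝ} {X : ZMod n → ℕ} (h : TropArr f X)
    (σ : ZMod n → ZMod n) : TropArr (fun s => f s ∘ σ) (X ∘ σ) :=
  fun i => h (σ i)

theorem TropArr.arr_ext {l : ℕ} {f : ℕ → ZMod n → ℝ} {X Y : Arr n l} (hX : TropArr f X.1)
    (hY : TropArr f Y.1) : X = Y :=
  Arr.ext fun i => (hX i).unique (hY i)

variable {f g : ℕ → ZMod n → ℝ} {l m : ℕ}

theorem tropArr_geomQ {X Y : ZMod n → ℕ} (hX : TropArr f X) (hY : TropArr g Y) :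
    TropArr (fun s => geomQ (f s) (g s)) (Q X Y) := fun i =>
  Trop.sum (f := fun k s => geomQTerm (f s) (g s) i k)
    (fun k => (Trop.prod (fun j : ℕ => hX (i + j)) _).mul (Trop.prod (fun j : ℕ => hY (i + j)) _)) _

theorem tropArr_geomRFst {X : Arr n l} {Y : Arr n m} (hX : TropArr f X.1) (hY : TropArr g Y.1) :
    TropArr (fun s => geomRFst (f s) (g s)) (R X Y).2.1 := fun i =>
  ((hX i).mul (tropArr_geomQ hX hY i)).div (tropArr_geomQ hX hY (i - 1)) (Q_pred_le X.1 Y.1 i)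

theorem tropArr_geomRSnd {X : Arr n l} {Y : Arr n m} (hX : TropArr f X.1) (hY : TropArr g Y.1) :
    TropArr (fun s => geomRSnd (f s) (g s)) (R X Y).1.1 := fun i =>
  ((hY i).mul (tropArr_geomQ hX hY (i - 1))).div (tropArr_geomQ hX hY i) (Q_le_pred X.1 Y.1 i)

theorem tropArr_geomV {X : Arr n l} {Y : Arr n m} (hX : TropArr f X.1) (hY : TropArr g Y.1) :
    TropArr (fun s => geomV (f s) (g s)) (RVee X Y).2.1 := fun i => by
  have h := ((hX i).mul ((hX (i + 1)).add (hY (i + 1)))).div ((hX i).add (hY i))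
    ((min_le_left _ _).trans (Nat.le_add_right _ _))
  simpa only [RVee, P, sub_add_cancel, geomV] using h

/-- `P` is symmetric in its two arguments. -/
theorem RVee_comm (X : Arr n l) (Y : Arr n m) : RVee X Y = ((RVee Y X).2, (RVee Y X).1) := by
  refine Prod.ext (Arr.ext fun i => ?_) (Arr.ext fun i => ?_) <;>
  simp only [RVee, P, min_comm]

theorem tropArr_geomV' {X : Arr n l} {Y : Arr n m} (hX : TropArr f X.1) (hY : TropArr g Y.1) :
    TropArr (fun s => geomV (g s) (f s)) (RVee X Y).1.1 := by
  rw [RVee_comm]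
  exact tropArr_geomV hY hX

theorem RVeeVee_eq (X : Arr n l) (Y : Arr n m) : RVeeVee X Y = ((R Y X).2, (R Y X).1) := rfl

/-- The monomial lift of an array of exponents. -/
noncomputable def lift (c : ℝ) (X : ZMod n → ℕ) (s : ℕ) (i : ZMod n) : ℝ := c / 2 ^ (X i * s)

theorem tropArr_lift {c : ℝ} (hc : 0 < c) (X : ZMod n → ℕ) : TropArr (lift c X) X := fun i =>
  ⟨c, c, hc, hc, fun s => by simp [lift]⟩

theorem prod_lift (c : ℝ) (X : Arr n l) (s : ℕ) :
    ∏ i, lift c X.1 s i = c ^ n / 2 ^ (l * s) := by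
  simp only [lift, Finset.prod_div_distrib, Finset.prod_const, Finset.card_univ, ZMod.card,
    Finset.prod_pow_eq_pow_sum, ← Finset.sum_mul, X.2]

/-- After clearing the powers of `2`, the prime `p` divides one side only. -/
theorem prod_lift_ne {p c : ℕ} (hp : p.Prime) (hp2 : p ≠ 2) (hpc : ¬ p ∣ c)
    (X : Arr n l) (Y : Arr n m) (s : ℕ) :
    ∏ i, lift c X.1 s i ≠ ∏ i, lift p Y.1 s i := by
  rw [prod_lift, prod_lift, Ne, div_eq_div_iff (by positivity) (by positivity)]
  intro h
  have h' : c ^ n * 2 ^ (m * s) = p ^ n * 2 ^ (l * s) := by exact_mod_cast h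
  have hd : p ∣ c ^ n * 2 ^ (m * s) := by
    rw [h']
    exact Dvd.dvd.mul_right (dvd_pow_self p (NeZero.ne n)) _
  rcases hp.dvd_mul.1 hd with h1 | h1
  · exact hpc (hp.dvd_of_dvd_pow h1)
  · exact hp2 ((Nat.prime_dvd_prime_iff_eq hp Nat.prime_two).1 (hp.dvd_of_dvd_pow h1))

end Tropicalization

/-! ### The combinatorial Yang–Baxter and reflection equations -/

section YangBaxter

variable {n : ℕ} [NeZero n] {k l m : ℕ}

theorem exists_lifts (x : Arr n l) (y : Arr n m) (w : Arr n k) :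
    ∃ f g h : ℕ → ZMod n → ℝ, TropArr f x.1 ∧ TropArr g y.1 ∧ TropArr h w.1 ∧
      ∀ s, ∏ i, f s i ≠ ∏ i, g s i ∧ ∏ i, f s i ≠ ∏ i, h s i ∧ ∏ i, g s i ≠ ∏ i, h s i :=
  ⟨lift (1 : ℕ) x.1, lift (3 : ℕ) y.1, lift (5 : ℕ) w.1, tropArr_lift (by norm_num) _,
    tropArr_lift (by norm_num) _, tropArr_lift (by norm_num) _, fun s =>
    ⟨prod_lift_ne Nat.prime_three (by norm_num) (by norm_num) _ _ _,
      prod_lift_ne Nat.prime_five (by norm_num) (by norm_num) _ _ _,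
      prod_lift_ne Nat.prime_five (by norm_num) (by norm_num) _ _ _⟩⟩

/-- The Yang–Baxter equation on `B_l ⊗ B_m ⊗ B_k`. -/
theorem R_yangBaxter (x : B n l) (y : B n m) (w : B n k) :
    let r₁ := R x y
    let r₂ := R r₁.2 w
    let r₃ := R r₁.1 r₂.1
    let s₁ := R y w
    let s₂ := R x s₁.1
    let s₃ := R s₂.2 s₁.2
    r₃.1 = s₂.1 ∧ r₃.2 = s₃.1 ∧ r₂.2 = s₃.2 := by
  intro r₁ r₂ r₃ s₁ s₂ s₃
  obtain ⟨f, g, h, hf, hg, hh, hne⟩ := exists_lifts x y w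
  have key := fun s => geomR_yangBaxter (hf.pos s) (hg.pos s) (hh.pos s) (hne s).1 (hne s).2.1
    (hne s).2.2
  have a := tropArr_geomRFst hf hg
  have b := tropArr_geomRSnd hf hg
  have ŷ := tropArr_geomRFst hg hh
  have ŵ := tropArr_geomRSnd hg hh
  have x' := tropArr_geomRFst hf ŵ
  have t₁ := tropArr_geomRSnd b (tropArr_geomRSnd a hh)
  have t₂ := tropArr_geomRFst b (tropArr_geomRSnd a hh)
  have t₃ := tropArr_geomRFst a hh
  -- The rational identity makes one family a lift of both sides, so their exponents agree.
  simp only [(key _).1, (key _).2.1, (key _).2.2] at t₁ t₂ t₃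
  exact ⟨t₁.arr_ext (tropArr_geomRSnd hf ŵ), t₂.arr_ext (tropArr_geomRSnd x' ŷ),
    t₃.arr_ext (tropArr_geomRFst x' ŷ)⟩

/-- The Yang–Baxter equation on `B_l ⊗ B_m ⊗ B^∨_k`. -/
theorem RVee_yangBaxter (x : B n l) (y : B n m) (w : BVee n k) :
    let r₁ := R x y
    let r₂ := RVee r₁.2 w
    let r₃ := RVee r₁.1 r₂.1
    let s₁ := RVee y w
    let s₂ := RVee x s₁.1
    let s₃ := R s₂.2 s₁.2
    r₃.1 = s₂.1 ∧ r₃.2 = s₃.1 ∧ r₂.2 = s₃.2 := by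
  intro r₁ r₂ r₃ s₁ s₂ s₃
  obtain ⟨f, g, h, hf, hg, hh, hne⟩ := exists_lifts x y w
  have key := fun s => geomV_yangBaxter (hf.pos s) (hg.pos s) (hh.pos s) (hne s).1
  have a := tropArr_geomRFst hf hg
  have b := tropArr_geomRSnd hf hg
  have ŷ := tropArr_geomV hg hh
  have ŵ := tropArr_geomV' hg hh
  have x' := tropArr_geomV hf ŵ
  have t₁ := tropArr_geomV' b (tropArr_geomV' a hh)
  have t₂ := tropArr_geomV b (tropArr_geomV' a hh)
  have t₃ := tropArr_geomV a hh
  simp only [(key _).1, (key _).2.1, (key _).2.2] at t₁ t₂ t₃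
  exact ⟨t₁.arr_ext (tropArr_geomV' hf ŵ), t₂.arr_ext (tropArr_geomRSnd x' ŷ),
    t₃.arr_ext (tropArr_geomRFst x' ŷ)⟩

/-- The Yang–Baxter equation on `B_l ⊗ B^∨_m ⊗ B^∨_k`. -/
theorem RVeeVee_yangBaxter (x : B n l) (y : BVee n m) (w : BVee n k) :
    let r₁ := RVee x y
    let r₂ := RVee r₁.2 w
    let r₃ := RVeeVee r₁.1 r₂.1
    let s₁ := RVeeVee y w
    let s₂ := RVee x s₁.1
    let s₃ := RVee s₂.2 s₁.2
    r₃.1 = s₂.1 ∧ r₃.2 = s₃.1 ∧ r₂.2 = s₃.2 := by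
  -- Reversing the order of the tensor factors turns `R^∨∨` into `R` and fixes `R^∨`, so this is the
  -- previous equation read backwards.
  have h := RVee_yangBaxter w y x
  simp only [RVeeVee_eq] at h ⊢
  rw [RVee_comm x y, RVee_comm _ w, RVee_comm x, RVee_comm _ (R w y).1]
  exact ⟨h.2.2.symm, h.2.1.symm, h.1.symm⟩

/-- The reflection equation on `B_l ⊗ B_m`. -/
theorem reflection (e : EndType n) (x : B n l) (y : B n m) :
    let r₁ := RVee x (kappa e y)
    let r₂ := RVeeVee r₁.1 (kappa e r₁.2)
    let s₁ := R x y
    let s₂ := RVee s₁.1 (kappa e s₁.2)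
    r₂.1 = s₂.1 ∧ r₂.2 = kappa e s₂.2 := by
  intro r₁ r₂ s₁ s₂
  obtain ⟨f, g, h, hf, hg, -, hne⟩ := exists_lifts x y x
  have key := fun s => geomReflection e (hf.pos s) (hg.pos s) (hne s).1
  have k1 := fun s => funext (key s).1
  have k2 := fun s => funext (key s).2
  have hy : TropArr (fun s => g s ∘ e.perm) (kappa e y).1 := hg.comp e.perm
  have hr : TropArr (fun s => geomV (f s) (g s ∘ e.perm) ∘ e.perm) (kappa e r₁.2).1 :=
    (tropArr_geomV hf hy).comp e.perm
  have hs : TropArr (fun s => geomRFst (f s) (g s) ∘ e.perm) (kappa e s₁.2).1 :=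
    (tropArr_geomRFst hf hg).comp e.perm
  have t₁ := tropArr_geomRFst hr (tropArr_geomV' hf hy)
  have t₂ := tropArr_geomRSnd hr (tropArr_geomV' hf hy)
  simp only [k1, k2] at t₁ t₂
  exact ⟨t₁.arr_ext (tropArr_geomV' (tropArr_geomRSnd hf hg) hs),
    t₂.arr_ext (Y := kappa e s₂.2) ((tropArr_geomV (tropArr_geomRSnd hf hg) hs).comp e.perm)⟩

end YangBaxter

/-! ### Dressed walls and commutation of the time evolutions -/

section Lattice

variable {n : ℕ} [NeZero n] {l m : ℕ}

theorem passRight_yangBaxter (x : B n l) (y : B n m) (b : LocalState n) :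
    let p₁ := passRight y b
    let p₂ := passRight x p₁.1
    let q₁ := passRight (R x y).2 b
    let q₂ := passRight (R x y).1 q₁.1
    p₂.1 = q₂.1 ∧ R p₂.2 p₁.2 = (q₂.2, q₁.2) := by
  have h1 := R_yangBaxter x y b.1
  have h2 := RVee_yangBaxter (R x (R y b.1).1).2 (R y b.1).2 b.2
  simp only at h1 h2
  rw [← h1.2.1, ← h1.2.2] at h2
  simp only [passRight]
  rw [h1.1]
  exact ⟨Prod.ext rfl h2.1.symm, Prod.ext h2.2.1.symm h2.2.2.symm⟩

theorem passLeft_yangBaxter (b : LocalState n) (w : BVee n l) (z : BVee n m) :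
    let p₁ := passLeft b w
    let p₂ := passLeft p₁.2 z
    let q₁ := passLeft b (RVeeVee w z).1
    let q₂ := passLeft q₁.2 (RVeeVee w z).2
    p₂.2 = q₂.2 ∧ RVeeVee p₁.1 p₂.1 = (q₁.1, q₂.1) := by
  have h1 := R_yangBaxter z w b.2
  have h2 := RVeeVee_yangBaxter b.1 (RVeeVee b.2 w).1 (RVeeVee (RVeeVee b.2 w).2 z).1
  simp only [RVeeVee_eq] at h1 h2
  rw [← h1.2.1, ← h1.2.2] at h2
  simp only [passLeft, RVeeVee_eq]
  rw [← h1.1]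
  exact ⟨Prod.ext h2.2.2 rfl, Prod.ext h2.1 h2.2.1⟩

/-- A carrier moving to the right crosses a site and a carrier moving to the left. -/
theorem passRight_passLeft (x : B n l) (b : LocalState n) (w : BVee n m) :
    let p₁ := passLeft b w
    let p₂ := RVee x p₁.1
    let p₃ := passRight p₂.2 p₁.2
    let q₁ := passRight x b
    let q₂ := RVee q₁.2 w
    let q₃ := passLeft q₁.1 q₂.1
    p₂.1 = q₃.1 ∧ p₃.1 = q₃.2 ∧ p₃.2 = q₂.2 := by
  have h1 := RVee_yangBaxter x b.1 (RVeeVee b.2 w).1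
  have h2 := RVeeVee_yangBaxter (R x b.1).2 b.2 w
  simp only at h1 h2
  simp only [passRight, passLeft]
  rw [← h1.2.1, ← h1.2.2, ← h1.1, h2.1, h2.2.1, h2.2.2]
  exact ⟨rfl, rfl, rfl⟩

/-- The wall together with the sites `s` in front of it acts on a carrier that comes from the
left: the carrier passes all sites, is reflected, and passes all sites again. -/
def dress (e : EndType n) : List (LocalState n) → B n l → BVee n l × List (LocalState n)
  | [], v => (kappa e v, [])
  | b :: s, v =>
    let r := passRight v b
    let d := dress e s r.2
    let t := passLeft r.1 d.1
    (t.1, t.2 :: d.2)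

/-- The reflection equation for a wall with sites in front of it. -/
theorem dress_reflection (e : EndType n) (s : List (LocalState n)) (x : B n l) (y : B n m) :
    let d₁ := dress e s y
    let r₁ := RVee x d₁.1
    let d₂ := dress e d₁.2 r₁.2
    let d₃ := dress e s (R x y).2
    let r₂ := RVee (R x y).1 d₃.1
    let d₄ := dress e d₃.2 r₂.2
    RVeeVee r₁.1 d₂.1 = (r₂.1, d₄.1) ∧ d₂.2 = d₄.2 := by
  induction s generalizing x y with
  | nil =>
    have h := reflection e x y
    exact ⟨Prod.ext h.1 h.2, rfl⟩
  | cons b s ih =>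
    -- `h₁`: both carriers enter the site, in either order. `h₂`, `h₃`: for each order, the second
    -- carrier on its way in meets the first on its way out. `h₄`: both are reflected by the shorter
    -- wall. `h₅`: both leave the site.
    have h₁ := passRight_yangBaxter x y b
    have h₂ := passRight_passLeft x (passRight y b).1 (dress e s (passRight y b).2).1
    have h₃ := passRight_passLeft (R x y).1 (passRight (R x y).2 b).1
      (dress e s (passRight (R x y).2 b).2).1
    have h₄ := ih (passRight x (passRight y b).1).2 (passRight y b).2
    have h₅ := fun w z => passLeft_yangBaxter (passRight x (passRight y b).1).1 (l := m) (m := l) w z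
    simp only at h₁ h₂ h₃ h₄ h₅
    rw [h₁.2] at h₄
    rw [h₁.1] at h₂ h₅
    simp only [dress]
    rw [h₂.1, h₂.2.1, h₂.2.2, h₃.1, h₃.2.1, h₃.2.2]
    refine ⟨?_, ?_⟩
    · rw [(h₅ _ _).2, h₄.1]
    · rw [(h₅ _ _).1, h₄.1, h₄.2]

/-- The time evolution is given by the action of the dressed wall on `u_l`. -/
theorem dress_state (e : EndType n) (l : ℕ) (p : State e) (N : ℕ) :
    dress e ((List.range N).map p.site).reverse (rightCarrier l p N) =
      (leftCarrier l p N, ((List.range N).map (T l p).site).reverse) := by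
  induction N with
  | zero => rfl
  | succ N ih =>
    simp only [List.range_succ, List.map_append, List.map_cons, List.map_nil,
      List.reverse_append, List.reverse_cons, List.reverse_nil, List.nil_append,
      List.singleton_append, dress, passRight_rightCarrier, ih]
    rfl

theorem exists_dress_state (e : EndType n) (l : ℕ) (p : State e) :
    ∃ N₀, ∀ N, N₀ ≤ N → dress e ((List.range N).map p.site).reverse (u n l) =
      (uVee e l, ((List.range N).map (T l p).site).reverse) := by
  obtain ⟨N₁, h₁⟩ := leftCarrier_eventually l p
  -- Beyond `p.range` the incoming carrier is still `u_l`; beyond `N₁` the outgoing one is already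
  -- `u^∨_l`.
  refine ⟨max p.range N₁, fun N hN => ?_⟩
  rw [← rightCarrier_of_le l p ((le_max_left _ _).trans hN), dress_state,
    (h₁ N ((le_max_right _ _).trans hN)).1]

theorem T_comm (e : EndType n) (l m : ℕ) (p : State e) : T l (T m p) = T m (T l p) := by
  obtain ⟨N₁, h₁⟩ := exists_dress_state e m p
  obtain ⟨N₂, h₂⟩ := exists_dress_state e l (T m p)
  obtain ⟨N₃, h₃⟩ := exists_dress_state e l p
  obtain ⟨N₄, h₄⟩ := exists_dress_state e m (T l p)
  have hsite : (T l (T m p)).site = (T m (T l p)).site := by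
    funext k
    -- The list must contain site `k` and be long enough for all four evolutions.
    set N := max (k + 1) (max (max N₁ N₂) (max N₃ N₄)) with hN
    have h := (dress_reflection e ((List.range N).map p.site).reverse (u n l) (u n m)).2
    simp only [R_u, h₁ N (by omega), h₃ N (by omega), RVee_u_uVee, h₂ N (by omega),
      h₄ N (by omega)] at h
    have h' := List.map_inj_left.1 (List.reverse_injective h)
    exact h' k (List.mem_range.2 (by omega))
  -- The remaining field of a state is a proof, so equality of the sites suffices.
  revert hsite
  generalize T l (T m p) = a
  generalize T m (T l p) = b
  rintro hsite
  cases a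
  cases b
  congr

end Lattice

end ReflectingAutomaton

theorem proposition3p4 (n : ℕ) [NeZero n] (hn : 3 ≤ n) (e : ReflectingAutomaton.EndType n)
    (l m : ℕ) (hl : 1 ≤ l) (hm : 1 ≤ m) (p : ReflectingAutomaton.State e) :
    ReflectingAutomaton.T l (ReflectingAutomaton.T m p) =
      ReflectingAutomaton.T m (ReflectingAutomaton.T l p) :=
  ReflectingAutomaton.T_comm e l m p
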